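/- Let $d\ge1$ be an integer, $d_\sharp=\left[\frac{d-1}{2}\right]+1$, and identify $\mathbb{T}^d=\mathbb{R}^d/\mathbb{Z}^d$ with $(-1/2,1/2]^d\subset\mathbb{R}^d$. For an integrable $F:\mathbb{R}^d\to\mathbb{C}$ put $\hat F(\xi)=\int_{\mathbb{R}^d}F(x)e^{-2\pi i\xi x}\,dx$ and $\sigma_\lambda(F)(x)=\int_{|\xi|<\lambda}\hat F(\xi)e^{2\pi i\xi x}\,d\xi$; for an integrable $f:\mathbb{T}^d\to\mathbb{C}$ put $\hat f(m)=\int_{\mathbb{T}^d}f(x)e^{-2\pi imx}\,dx$ $(m\in\mathbb{Z}^d)$ and $S_\lambda(f)(x)=\sum_{|m|<\lambda}\hat f(m)e^{2\pi imx}$. The periodization of $F$ is $f(x)=\sum_{m\in\mathbb{Z}^d}F(x+m)$, $x\in\mathbb{T}^d$. For $\alpha>-1$, $s\ge0$ and $x\in\mathbb{R}^d$ let $$D_\alpha(s:x)=\frac1{\Gamma(\alpha+1)}\sum_{|m|^2<s}(s-|m|^2)^\alpha e^{2\pi imx},\qquad \mathcal{D}_\alpha(s:x)=\frac1{\Gamma(\alpha+1)}\int_{|\xi|^2<s}(s-|\xi|^2)^\alpha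 e^{2\pi ix\xi}\,d\xi$$ (both equal to $0$ for $s=0$), and $\Delta_\alpha(s:x)=D_\alpha(s:x)-\mathcal{D}_\alpha(s:x)$. With $J_\nu$ the Bessel function of the first kind of order $\nu>-1$, let $\Lambda_\nu(t:s)=J_\nu(2\pi t\sqrt s)/s^{\nu/2}$ for $t>0$, $s>0$ and $\Lambda_\nu(t:0)=(\pi t)^\nu/\Gamma(\nu+1)$. For a function $\phi:[0,\infty)\to\mathbb{C}$ let $F_\phi(x)=\phi(|x|)$, $x\in\mathbb{R}^d$, let $f_\phi$ be the periodization of $F_\phi$, and let $$A_\phi(s)=2\pi\int_0^\infty\phi(t)\,\Lambda_{\frac d2-1}(t:s)\,t^{\frac d2}\,dt,\qquad s\ge0.$$ **Theorem.** Let $\phi$ be a function on $[0,\infty)$ with compact support such that $F_\phi$ is integrable on $\mathbb{R}^d$. Then $f_\phi$ is integrable on $\mathbb{T}^d$, $A_\phi$ is infinitely differentiable on $[0,\infty)$ (with one-sided derivatives at $0$), and for all $\lambda\ge0$ and all $x\in\mathbb{T}^d$ $$S_\lambda(f_\phi)(x)=\sigma_\lambda(F_\phi)(x)+\sum_{j=0}^{d_\sharp}(-1)^j\Delta_j(\lambda^2:x)A_\phi^{(j)}(\lambda^2)+(-1)^{d_\sharp+1}\sum_{m\in\mathbb{Z}^d\setminus\{0\}}\int_0^{\lambda^2}\mathcal{D}_{d_\sharp}(s:x-m)A_\phi^{(d_\sharp+1)}(s)\,ds,$$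 where the integrals exist and the series over $m$ converges absolutely. **Corollary.** Let $\beta>-1$ and $a>0$, let $\phi_{\beta,a}(t)=(a^2-t^2)^\beta$ for $0\le t<a$ and $\phi_{\beta,a}(t)=0$ for $t\ge a$, let $U_{\beta,a}(x)=\phi_{\beta,a}(|x|)$, $x\in\mathbb{R}^d$, let $u_{\beta,a}$ be the periodization of $U_{\beta,a}$, and write $A_{\beta,a}=A_{\phi_{\beta,a}}$. Then $U_{\beta,a}$ is integrable on $\mathbb{R}^d$, $u_{\beta,a}$ is integrable on $\mathbb{T}^d$, $A_{\beta,a}$ is infinitely differentiable on $[0,\infty)$, and for all $\lambda\ge0$ and all $x\in\mathbb{T}^d$ $$S_\lambda(u_{\beta,a})(x)=\sigma_\lambda(U_{\beta,a})(x)+\sum_{j=0}^{d_\sharp}(-1)^j\Delta_j(\lambda^2:x)A_{\beta,a}^{(j)}(\lambda^2)+(-1)^{d_\sharp+1}\sum_{m\in\mathbb{Z}^d\setminus\{0\}}\int_0^{\lambda^2}\mathcal{D}_{d_\sharp}(s:x-m)A_{\beta,a}^{(d_\sharp+1)}(s)\,ds,$$ where again the integrals exist and the series over $m$ converges absolutely.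 -/

import Mathlib

open MeasureTheory Set
open scoped NNReal FourierTransform ContDiff

noncomputable section

namespace LatticeFourier

/-- `ℝ^d` with the Euclidean norm. -/
abbrev E (d : ℕ) := EuclideanSpace ℝ (Fin d)

/-- The lattice point `m ∈ ℤ^d`, viewed in `ℝ^d`. -/
def latt {d : ℕ} (m : Fin d → ℤ) : E d := WithLp.toLp 2 (fun i => (m i : ℝ))

theorem finite_norm_lt (d : ℕ) (r : ℝ) : {m : Fin d → ℤ | ‖latt m‖ < r}.Finite := by
  refine (Set.finite_Icc (fun _ : Fin d => -⌈r⌉) (fun _ => ⌈r⌉)).subset ?_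
  intro m hm
  have key : ∀ i, |(m i : ℝ)| ≤ (⌈r⌉ : ℝ) := by
    intro i
    have h := PiLp.norm_apply_le (latt m) i
    simp only [latt, Real.norm_eq_abs] at h
    exact h.trans ((le_of_lt hm).trans (Int.le_ceil r))
  refine ⟨fun i => ?_, fun i => ?_⟩
  · have h := (abs_le.mp (key i)).1
    exact_mod_cast h
  · have h := (abs_le.mp (key i)).2
    exact_mod_cast h

theorem finite_norm_sq_lt (d : ℕ) (s : ℝ) : {m : Fin d → ℤ | ‖latt m‖ ^ 2 < s}.Finite := by
  refine (finite_norm_lt d (Real.sqrt s)).subset ?_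
  intro m hm
  exact Real.lt_sqrt_of_sq_lt hm

/-- The character `e^{2πi⟨ξ,x⟩}`. -/
def e {d : ℕ} (ξ x : E d) : ℂ :=
  Complex.exp (2 * (Real.pi : ℂ) * Complex.I * ((inner ℝ ξ x : ℝ) : ℂ))

/-- The torus `𝕋^d`, identified with `(-1/2, 1/2]^d ⊆ ℝ^d`. -/
def torus (d : ℕ) : Set (E d) := {x | ∀ i, x i ∈ Ioc (-(1 / 2) : ℝ) (1 / 2)}

/-- The spherical partial Fourier integral `σ_r(F)(x) = ∫_{|ξ|<r} F̂(ξ) e^{2πiξx} dξ`;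
`𝓕 F ξ = ∫ F(x) e^{-2πi⟨x,ξ⟩} dx`. -/
def sphericalIntegral {d : ℕ} (r : ℝ) (F : E d → ℂ) (x : E d) : ℂ :=
  ∫ ξ in {ξ : E d | ‖ξ‖ < r}, 𝓕 F ξ * e ξ x

/-- The Fourier coefficient `f̂(m) = ∫_{𝕋^d} f(x) e^{-2πimx} dx`. -/
def fourierCoefficient {d : ℕ} (f : E d → ℂ) (m : Fin d → ℤ) : ℂ :=
  ∫ x in torus d, f x * e (-latt m) x

/-- The spherical partial sum `S_r(f)(x) = ∑_{|m|<r} f̂(m) e^{2πimx}`. -/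
def sphericalSum {d : ℕ} (r : ℝ) (f : E d → ℂ) (x : E d) : ℂ :=
  ∑ m ∈ (finite_norm_lt d r).toFinset, fourierCoefficient f m * e (latt m) x

/-- The periodization `f(x) = ∑_{m ∈ ℤ^d} F(x + m)`. For `F` of bounded support, which is the
only case used, every such sum has finitely many nonzero terms. -/
def periodization {d : ℕ} (F : E d → ℂ) (x : E d) : ℂ :=
  ∑' m : Fin d → ℤ, F (x + latt m)

/-- The radial function `F_φ(x) = φ(|x|)` on `ℝ^d`. -/
def radial (d : ℕ) (φ : ℝ≥0 → ℂ) (x : E d) : ℂ := φ ‖x‖₊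

/-- The Bessel function of the first kind `J_ν(s)`, for `ν > -1` and `s > 0`. -/
def besselJ (ν s : ℝ) : ℝ :=
  ∑' k : ℕ, (-1) ^ k / ((Nat.factorial k : ℝ) * Real.Gamma (ν + k + 1)) *
    (s / 2) ^ (2 * (k : ℝ) + ν)

/-- `Λ_ν(t:s) = J_ν(2πt√s) / s^{ν/2}` for `s > 0`, and `Λ_ν(t:0) = (πt)^ν / Γ(ν+1)`. -/
def Lam (ν t s : ℝ) : ℝ :=
  if s = 0 then (Real.pi * t) ^ ν / Real.Gamma (ν + 1)
  else besselJ ν (2 * Real.pi * t * Real.sqrt s) / s ^ (ν / 2)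

/-- `A_φ(s) = 2π ∫_0^∞ φ(t) Λ_{d/2-1}(t:s) t^{d/2} dt`, for `s ≥ 0`. -/
def A (d : ℕ) (φ : ℝ≥0 → ℂ) (s : ℝ) : ℂ :=
  2 * (Real.pi : ℂ) * ∫ t in Ioi (0 : ℝ),
    φ t.toNNReal * ((Lam ((d : ℝ) / 2 - 1) t s * t ^ ((d : ℝ) / 2) : ℝ) : ℂ)

/-- The derivative `A_φ^{(j)}(s)` of `A_φ` as a function on `[0,∞)` (one-sided at `s = 0`). -/
def Aderiv (d : ℕ) (φ : ℝ≥0 → ℂ) (j : ℕ) (s : ℝ) : ℂ :=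
  iteratedDerivWithin j (A d φ) (Ici 0) s

/-- The lattice Riesz mean
`D_α(s:x) = Γ(α+1)⁻¹ ∑_{|m|²<s} (s-|m|²)^α e^{2πimx}` (the empty sum for `s = 0`). -/
def Dsum {d : ℕ} (α s : ℝ) (x : E d) : ℂ :=
  ((Real.Gamma (α + 1) : ℝ) : ℂ)⁻¹ *
    ∑ m ∈ (finite_norm_sq_lt d s).toFinset,
      (((s - ‖latt m‖ ^ 2) ^ α : ℝ) : ℂ) * e (latt m) x

/-- Its continuous analogue
`𝒟_α(s:x) = Γ(α+1)⁻¹ ∫_{|ξ|²<s} (s-|ξ|²)^α e^{2πixξ} dξ` (zero for `s = 0`). -/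
def Dint {d : ℕ} (α s : ℝ) (x : E d) : ℂ :=
  ((Real.Gamma (α + 1) : ℝ) : ℂ)⁻¹ *
    ∫ ξ in {ξ : E d | ‖ξ‖ ^ 2 < s}, (((s - ‖ξ‖ ^ 2) ^ α : ℝ) : ℂ) * e ξ x

/-- The discrepancy `Δ_α(s:x) = D_α(s:x) - 𝒟_α(s:x)`. -/
def Delta {d : ℕ} (α s : ℝ) (x : E d) : ℂ := Dsum α s x - Dint α s x

/-- `d♯ = [(d-1)/2] + 1`, the smallest integer greater than `(d-1)/2` (for `d ≥ 1`). -/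
def dSharp (d : ℕ) : ℕ := (d - 1) / 2 + 1

/-- `φ_{β,a}(t) = (a²-t²)^β` for `0 ≤ t < a`, and `0` for `t ≥ a`. -/
def phiBeta (β a : ℝ) (t : ℝ≥0) : ℂ :=
  if (t : ℝ) < a then (((a ^ 2 - (t : ℝ) ^ 2) ^ β : ℝ) : ℂ) else 0

/-- `U_{β,a}(x) = (a²-|x|²)^β` for `|x| < a`, and `0` for `|x| ≥ a`. -/
def U (d : ℕ) (β a : ℝ) (x : E d) : ℂ :=
  if ‖x‖ < a then (((a ^ 2 - ‖x‖ ^ 2) ^ β : ℝ) : ℂ) else 0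

/-- `u_{β,a}`, the periodization of `U_{β,a}`. -/
def u (d : ℕ) (β a : ℝ) : E d → ℂ := periodization (U d β a)

end LatticeFourier

end

open LatticeFourier

/-!
The Fourier transform of `F_φ` is `A_φ(|ξ|²)`; the Bessel function in it comes from the moments of
the sphere, which are read off from those of the Gaussian. Hence `S_λ(f_φ)` and `σ_λ(F_φ)` are the
lattice sum and the integral of `A_φ(|ξ|²) e^{2πiξx}` over the same ball.
Taylor's formula for `A_φ` at `λ²`, with integral remainder, turns both into combinations of the
Riesz means `D_j` and `𝒟_j`, since the remainder kernel `(s - |ξ|²)₊ᵏ / k!` is itself the kernel of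
a Riesz mean of order `k`. In the difference the remainder contains `Δ_k(s : x)`, which is
`∑_{m ≠ 0} 𝒟_k(s : x - m)` by Poisson summation. The series converges absolutely as soon as
`d ≤ 2k`: Sonine's first finite integral and `J_ν(r) = O(r^{-1/2})` give
`𝒟_k(s : y) = O(|y|^{-(d/2 + k + 1/2)})`.
-/

noncomputable section

namespace LatticeFourier

section PowerSeries

variable {𝕜 : Type*} [RCLike 𝕜]

theorem hasDerivAt_tsum_mul_pow {c : ℕ → 𝕜} (hc : ∀ x, Summable fun j => c j * x ^ j) (x : 𝕜) :
    HasDerivAt (fun x => ∑' j, c j * x ^ j) (∑' j : ℕ, (j + 1) * c (j + 1) * x ^ j) x := by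
  set R : ℝ := ‖x‖ + 1
  have hR : 1 ≤ R := le_add_of_nonneg_left (norm_nonneg x)
  have hx : x ∈ Metric.ball (0 : 𝕜) R := by simp [R]
  have bound (j : ℕ) (z : 𝕜) (hz : z ∈ Metric.ball (0 : 𝕜) R) :
      ‖c j * (j * z ^ (j - 1))‖ ≤ ‖c j * ((2 * R : ℝ) : 𝕜) ^ j‖ := by
    have hzR : ‖z‖ ≤ R := (mem_ball_zero_iff.mp hz).le
    rw [norm_mul, norm_mul, norm_pow, norm_mul, norm_pow, RCLike.norm_natCast,
      RCLike.norm_of_nonneg (by positivity), mul_pow]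
    have hj : (j : ℝ) ≤ 2 ^ j := by exact_mod_cast j.lt_two_pow_self.le
    have hpow : ‖z‖ ^ (j - 1) ≤ R ^ j :=
      (pow_le_pow_left₀ (norm_nonneg z) hzR _).trans (pow_le_pow_right₀ hR (Nat.sub_le j 1))
    gcongr
  have hderiv := hasDerivAt_tsum_of_isPreconnected (hc ((2 * R : ℝ) : 𝕜)).norm Metric.isOpen_ball
    (convex_ball (0 : 𝕜) R).isPreconnected
    (fun j z _ => (hasDerivAt_pow j z).const_mul (c j)) bound hx (hc x) hx
  refine hderiv.congr_deriv ?_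
  have hs : Summable fun j : ℕ => c j * (j * x ^ (j - 1)) :=
    .of_norm_bounded (hc ((2 * R : ℝ) : 𝕜)).norm fun j => bound j x hx
  rw [hs.tsum_eq_zero_add]
  simp only [Nat.cast_zero, zero_mul, mul_zero, zero_add, Nat.add_sub_cancel]
  exact tsum_congr fun j => by push_cast; ring

end PowerSeries

/-- The `j`-th Taylor coefficient of the Bessel–Clifford function of order `ν`. Where `Γ` has a
pole, `Real.Gamma` vanishes and the quotient is `0`, which is the right value of `1 / Γ`. -/
def besselCliffordCoeff (ν : ℝ) (j : ℕ) : ℝ :=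
  (-1) ^ j / ((Nat.factorial j : ℝ) * Real.Gamma (ν + j + 1))

/-- The Bessel–Clifford function, with the sign for which `J_ν(2√u) = u^{ν/2} besselClifford ν u`.
It is the entire function underlying `J_ν`. -/
def besselClifford (ν u : ℝ) : ℝ := ∑' j : ℕ, besselCliffordCoeff ν j * u ^ j

theorem inv_Gamma_eq_mul_inv_Gamma_add_one (s : ℝ) :
    (Real.Gamma s)⁻¹ = s * (Real.Gamma (s + 1))⁻¹ := by
  rcases eq_or_ne s 0 with rfl | hs
  · simp
  · rw [Real.Gamma_add_one hs, mul_inv, mul_inv_cancel_left₀ hs]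

theorem besselCliffordCoeff_eq_mul (ν : ℝ) (j : ℕ) :
    besselCliffordCoeff ν j = (ν + j + 1) * besselCliffordCoeff (ν + 1) j := by
  simp only [besselCliffordCoeff, div_eq_mul_inv, mul_inv,
    inv_Gamma_eq_mul_inv_Gamma_add_one (ν + j + 1)]
  rw [show ν + 1 + j + 1 = ν + j + 1 + 1 by ring]
  ring

theorem succ_mul_besselCliffordCoeff_succ (ν : ℝ) (j : ℕ) :
    (j + 1) * besselCliffordCoeff ν (j + 1) = -besselCliffordCoeff (ν + 1) j := by
  simp only [besselCliffordCoeff, Nat.factorial_succ, pow_succ, div_eq_mul_inv, mul_inv]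
  push_cast
  rw [show ν + (j + 1) + 1 = ν + 1 + j + 1 by ring]
  field

theorem summable_besselClifford (ν u : ℝ) :
    Summable fun j => besselCliffordCoeff ν j * u ^ j := by
  refine summable_of_ratio_norm_eventually_le one_half_lt_one ?_
  filter_upwards [Filter.eventually_ge_atTop ⌈2 * |u| + |ν|⌉₊] with j hj
  have hj' : 2 * |u| + |ν| ≤ j := Nat.ceil_le.mp hj
  have hratio : besselCliffordCoeff ν j
      = -((j + 1) * (ν + j + 1)) * besselCliffordCoeff ν (j + 1) := by
    linear_combination besselCliffordCoeff_eq_mul ν j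
      + (ν + j + 1) * succ_mul_besselCliffordCoeff_succ ν j
  have hgrowth : 2 * |u| ≤ (j + 1) * (ν + j + 1) := by
    nlinarith [neg_abs_le ν, abs_nonneg u, abs_nonneg ν]
  rw [hratio, norm_mul, norm_mul, norm_mul, norm_neg, pow_succ, norm_mul,
    Real.norm_of_nonneg ((by positivity : 0 ≤ 2 * |u|).trans hgrowth), Real.norm_eq_abs u]
  nlinarith [mul_le_mul_of_nonneg_right hgrowth
    (by positivity : 0 ≤ ‖besselCliffordCoeff ν (j + 1)‖ * ‖u ^ j‖)]

theorem besselClifford_zero (ν : ℝ) : besselClifford ν 0 = (Real.Gamma (ν + 1))⁻¹ := by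
  rw [besselClifford, tsum_eq_single 0 fun j hj => by simp [hj]]
  simp [besselCliffordCoeff]

theorem hasDerivAt_besselClifford (ν u : ℝ) :
    HasDerivAt (besselClifford ν) (-besselClifford (ν + 1) u) u := by
  refine (hasDerivAt_tsum_mul_pow (summable_besselClifford ν) u).congr_deriv ?_
  simp_rw [succ_mul_besselCliffordCoeff_succ, neg_mul, tsum_neg, besselClifford]

@[fun_prop]
theorem continuous_besselClifford (ν : ℝ) : Continuous (besselClifford ν) :=
  continuous_iff_continuousAt.mpr fun u => (hasDerivAt_besselClifford ν u).continuousAt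

theorem besselClifford_recurrence (ν u : ℝ) :
    besselClifford ν u
      = (ν + 1) * besselClifford (ν + 1) u - u * besselClifford (ν + 2) u := by
  have h := summable_besselClifford ν u
  have h₁ := (summable_besselClifford (ν + 1) u).mul_left (ν + 1)
  have h₂ := (summable_besselClifford (ν + 2) u).mul_left u
  rw [besselClifford, besselClifford, besselClifford, ← tsum_mul_left, ← tsum_mul_left,
    h.tsum_eq_zero_add, h₁.tsum_eq_zero_add, add_sub_assoc,
    ← ((summable_nat_add_iff 1).mpr h₁).tsum_sub h₂]
  congr 1
  · rw [besselCliffordCoeff_eq_mul]; simp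
  · refine tsum_congr fun j => ?_
    have hcoeff := succ_mul_besselCliffordCoeff_succ (ν + 1) j
    rw [show ν + 1 + 1 = ν + 2 by ring] at hcoeff
    rw [besselCliffordCoeff_eq_mul ν (j + 1)]
    push_cast
    linear_combination u ^ (j + 1) * hcoeff

theorem hasDerivAt_besselClifford_mul_sq (ν c t : ℝ) :
    HasDerivAt (fun t : ℝ => besselClifford ν (c * t ^ 2))
      (-(2 * c * t * besselClifford (ν + 1) (c * t ^ 2))) t := by
  have hsq : HasDerivAt (fun t : ℝ => c * t ^ 2) (c * (2 * t)) t := by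
    simpa using (hasDerivAt_pow 2 t).const_mul c
  refine ((hasDerivAt_besselClifford ν (c * t ^ 2)).comp t hsq).congr_deriv ?_
  ring

theorem hasDerivAt_pow_mul_besselClifford (N : ℕ) (c t : ℝ) :
    HasDerivAt (fun t : ℝ => t ^ (N + 1) * besselClifford ((N + 1) / 2) (c * t ^ 2))
      (2 * t ^ N * besselClifford ((N + 1) / 2 - 1) (c * t ^ 2)) t := by
  refine ((hasDerivAt_pow (N + 1) t).mul
    (hasDerivAt_besselClifford_mul_sq ((N + 1) / 2) c t)).congr_deriv ?_
  rw [besselClifford_recurrence ((N + 1) / 2 - 1), sub_add_cancel,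
    show (N + 1 : ℝ) / 2 - 1 + 2 = (N + 1) / 2 + 1 by ring]
  push_cast
  ring

-- Up to the factor `exp (c / t)`, `c = |κ| / a`, the energy `v² + a² u²` is decreasing.
theorem exists_bound_of_perturbed_oscillator {a κ : ℝ} (ha : 0 < a) {u v : ℝ → ℝ}
    (hu : ∀ t, 1 ≤ t → HasDerivAt u (v t) t)
    (hv : ∀ t, 1 ≤ t → HasDerivAt v (-(a ^ 2 + κ / t ^ 2) * u t) t) :
    ∃ C, ∀ t, 1 ≤ t → |u t| ≤ C := by
  set c : ℝ := |κ| / a with hc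
  set energy : ℝ → ℝ := fun t => v t ^ 2 + a ^ 2 * u t ^ 2
  have hderiv (t : ℝ) (ht : 1 ≤ t) : HasDerivAt (fun t => energy t * Real.exp (c / t))
      (-(2 * κ * (u t * v t) + c * energy t) / t ^ 2 * Real.exp (c / t)) t := by
    have ht0 : t ≠ 0 := (zero_lt_one.trans_le ht).ne'
    have henergy := ((hv t ht).pow 2).add (((hu t ht).pow 2).const_mul (a ^ 2))
    have hweight := (((hasDerivAt_inv ht0).const_mul c)).exp
    refine (henergy.mul hweight).congr_deriv ?_
    simp only [energy, Pi.pow_apply, Pi.add_apply]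
    field_simp
    ring
  have hnonpos (t : ℝ) : 0 ≤ 2 * κ * (u t * v t) + c * energy t := by
    have hamgm : 2 * a * |u t * v t| ≤ energy t := by
      simp only [energy, abs_mul]
      nlinarith [sq_nonneg (|v t| - a * |u t|), sq_abs (u t), sq_abs (v t)]
    have hκ : |κ| * (2 * |u t * v t|) ≤ c * energy t := by
      calc |κ| * (2 * |u t * v t|) = c * (2 * a * |u t * v t|) := by rw [hc]; field
        _ ≤ c * energy t := by gcongr
    have hcross := neg_abs_le (κ * (u t * v t))
    rw [abs_mul] at hcross
    linarith
  have hanti : AntitoneOn (fun t => energy t * Real.exp (c / t)) (Ici 1) := by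
    refine antitoneOn_of_hasDerivWithinAt_nonpos (convex_Ici 1)
      (fun t ht => (hderiv t ht).continuousAt.continuousWithinAt)
      (fun t ht => (hderiv t (interior_subset ht)).hasDerivWithinAt) fun t _ => ?_
    exact mul_nonpos_of_nonpos_of_nonneg
      (div_nonpos_of_nonpos_of_nonneg (neg_nonpos.mpr (hnonpos t)) (sq_nonneg t))
      (Real.exp_pos _).le
  refine ⟨√(energy 1 * Real.exp c) / a, fun t ht => ?_⟩
  rw [le_div_iff₀ ha]
  refine Real.le_sqrt_of_sq_le ?_
  calc (|u t| * a) ^ 2 ≤ energy t := by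
        rw [mul_pow, sq_abs]; simp only [energy]; nlinarith [sq_nonneg (v t)]
    _ ≤ energy t * Real.exp (c / t) :=
        le_mul_of_one_le_right (by positivity) (Real.one_le_exp (by positivity))
    _ ≤ energy 1 * Real.exp c := by simpa using hanti self_mem_Ici ht ht

-- `t ^ (ν + 1 / 2) * besselClifford ν (t ^ 2)`, i.e. `√t J_ν(2t)`, solves
-- `u'' = -(4 - (ν² - 1 / 4) / t²) u`.
theorem exists_rpow_mul_besselClifford_bound {ν : ℝ} (hν : -(1 / 2) ≤ ν) :
    ∃ C, ∀ t, 0 ≤ t → |t ^ (ν + 1 / 2) * besselClifford ν (t ^ 2)| ≤ C := by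
  set μ : ℝ := ν + 1 / 2 with hμ
  set u : ℝ → ℝ := fun t => t ^ μ * besselClifford ν (t ^ 2)
  set v : ℝ → ℝ := fun t =>
    t ^ μ * (μ * t⁻¹ * besselClifford ν (t ^ 2) - 2 * t * besselClifford (ν + 1) (t ^ 2))
  have dB (α t : ℝ) : HasDerivAt (fun t : ℝ => besselClifford α (t ^ 2))
      (-(2 * t * besselClifford (α + 1) (t ^ 2))) t := by
    simpa using hasDerivAt_besselClifford_mul_sq α 1 t
  have dpow (t : ℝ) (ht : 1 ≤ t) : HasDerivAt (fun t : ℝ => t ^ μ) (t ^ μ * (μ * t⁻¹)) t := by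
    have ht0 : 0 < t := by linarith
    refine (Real.hasDerivAt_rpow_const (.inl ht0.ne')).congr_deriv ?_
    rw [Real.rpow_sub_one ht0.ne']; ring
  have hu (t : ℝ) (ht : 1 ≤ t) : HasDerivAt u (v t) t :=
    ((dpow t ht).mul (dB ν t)).congr_deriv (by simp only [v]; ring)
  have hv (t : ℝ) (ht : 1 ≤ t) : HasDerivAt v (-(2 ^ 2 + -(μ * (μ - 1)) / t ^ 2) * u t) t := by
    have ht0 : t ≠ 0 := by positivity
    have hinner := (((hasDerivAt_inv ht0).const_mul μ).mul (dB ν t)).sub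
      (((hasDerivAt_id t).const_mul 2).mul (dB (ν + 1) t))
    refine ((dpow t ht).mul hinner).congr_deriv ?_
    simp only [Pi.sub_apply, Pi.mul_apply, id, u]
    rw [besselClifford_recurrence ν (t ^ 2), show ν + 1 + 1 = ν + 2 by ring,
      show ν = μ - 1 / 2 by rw [hμ]; ring]
    field
  obtain ⟨C₁, hC₁⟩ := exists_bound_of_perturbed_oscillator two_pos hu hv
  have hcont : Continuous u :=
    (Real.continuous_rpow_const (by rw [hμ]; linarith)).mul (by fun_prop)
  obtain ⟨C₀, hC₀⟩ := isCompact_Icc.exists_bound_of_continuousOn (s := Icc (0 : ℝ) 1)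
    hcont.continuousOn
  refine ⟨max C₀ C₁, fun t ht => ?_⟩
  rcases le_total t 1 with h | h
  · exact le_max_of_le_left (hC₀ t ⟨ht, h⟩)
  · exact le_max_of_le_right (hC₁ t h)

theorem Lam_eq_besselClifford (ν : ℝ) {t s : ℝ} (ht : 0 < t) (hs : 0 ≤ s) :
    Lam ν t s = (Real.pi * t) ^ ν * besselClifford ν (Real.pi ^ 2 * t ^ 2 * s) := by
  rcases hs.eq_or_lt with rfl | hs
  · simp [Lam, besselClifford_zero, div_eq_mul_inv]
  rw [Lam, if_neg hs.ne', besselJ, besselClifford, ← tsum_mul_left, ← tsum_div_const]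
  refine tsum_congr fun j => ?_
  have hsν : s ^ (ν / 2) ≠ 0 := (Real.rpow_pos_of_pos hs _).ne'
  have hsqrt : √s ^ (2 * (j : ℝ) + ν) = s ^ j * s ^ (ν / 2) := by
    rw [Real.sqrt_eq_rpow, ← Real.rpow_mul hs.le, ← Real.rpow_natCast, ← Real.rpow_add hs]
    congr 1; ring
  have hπt : (Real.pi * t) ^ (2 * (j : ℝ) + ν) = (Real.pi * t) ^ (2 * j) * (Real.pi * t) ^ ν := by
    rw [Real.rpow_add (by positivity), ← Nat.cast_ofNat, ← Nat.cast_mul, Real.rpow_natCast]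
  rw [show 2 * Real.pi * t * √s / 2 = Real.pi * t * √s by ring,
    Real.mul_rpow (by positivity) (Real.sqrt_nonneg s), hsqrt, hπt, besselCliffordCoeff]
  field

section PolarCoordinates

variable {V F : Type*} [NormedAddCommGroup V] [NormedSpace ℝ V] [FiniteDimensional ℝ V]
  [Nontrivial V] [MeasurableSpace V] [BorelSpace V] [NormedAddCommGroup F] [NormedSpace ℝ F]

theorem integral_polar (μ : Measure V) [μ.IsAddHaarMeasure] {f : V → F} (hf : Integrable f μ) :
    ∫ x, f x ∂μ = ∫ t in Ioi (0 : ℝ),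
      t ^ (Module.finrank ℝ V - 1) • ∫ θ, f (t • θ.1) ∂μ.toSphere := by
  have hmp := μ.measurePreserving_homeomorphUnitSphereProd
  have hemb := (homeomorphUnitSphereProd V).measurableEmbedding
  set g : Metric.sphere (0 : V) 1 × Ioi (0 : ℝ) → F := fun p => f (p.2.1 • p.1.1)
  have hgf (x : ({0}ᶜ : Set V)) : g (homeomorphUnitSphereProd V x) = f x := by
    have : (‖x.1‖ : ℝ) ≠ 0 := norm_ne_zero_iff.mpr x.2
    simp [g, smul_smul, this]
  have hint : Integrable g (μ.toSphere.prod (.volumeIoiPow (Module.finrank ℝ V - 1))) := by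
    rw [← hmp.integrable_comp_emb hemb, show g ∘ _ = fun x => f x.1 from funext hgf]
    exact (integrableOn_iff_comap_subtypeVal (measurableSet_singleton _).compl).mp
      hf.integrableOn
  calc ∫ x, f x ∂μ = ∫ x : ({0}ᶜ : Set V), f x.1 ∂(μ.comap Subtype.val) := by
        rw [integral_subtype_comap (measurableSet_singleton _).compl f, restrict_compl_singleton]
    _ = ∫ p, g p ∂(μ.toSphere.prod (.volumeIoiPow (Module.finrank ℝ V - 1))) := by
        rw [← hmp.integral_comp hemb]
        exact integral_congr_ae (.of_forall fun x => (hgf x).symm)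
    _ = ∫ t : Ioi (0 : ℝ), ∫ θ, f (t.1 • θ.1) ∂μ.toSphere
          ∂(.volumeIoiPow (Module.finrank ℝ V - 1)) := integral_prod_symm _ hint
    _ = _ := by
      simp only [Measure.volumeIoiPow, ENNReal.ofReal]
      rw [integral_withDensity_eq_integral_smul
          (measurable_subtype_coe.pow_const _).real_toNNReal,
        integral_subtype_comap measurableSet_Ioi fun t ↦
          Real.toNNReal (t ^ (Module.finrank ℝ V - 1)) • ∫ θ, f (t • θ.1) ∂μ.toSphere]
      refine setIntegral_congr_fun measurableSet_Ioi fun t ht ↦ ?_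
      simp only [NNReal.smul_def, Real.coe_toNNReal _ (pow_nonneg (le_of_lt ht) _)]

end PolarCoordinates

section SphereFourier

variable {V : Type*} [NormedAddCommGroup V] [InnerProductSpace ℝ V] [FiniteDimensional ℝ V]
  [MeasurableSpace V] [BorelSpace V]

/-- The moment `∫ ⟨θ, y⟩^k dθ` of the surface measure of the unit sphere, from which the Taylor
series of the Fourier transform of the sphere is computed. -/
def sphereMoment (k : ℕ) (y : V) : ℝ := ∫ θ, inner ℝ θ.1 y ^ k ∂(volume : Measure V).toSphere

theorem hasSum_integral_sphere_exp (z : ℂ) (y : V) :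
    HasSum (fun k : ℕ => z ^ k / (Nat.factorial k : ℂ) * sphereMoment k y)
      (∫ θ, Complex.exp (z * (inner ℝ θ.1 y : ℝ)) ∂(volume : Measure V).toSphere) := by
  have hterm (k : ℕ) : z ^ k / (Nat.factorial k : ℂ) * sphereMoment k y
      = ∫ θ, z ^ k / (Nat.factorial k : ℂ) * ((inner ℝ θ.1 y : ℝ) : ℂ) ^ k
          ∂(volume : Measure V).toSphere := by
    rw [integral_const_mul, sphereMoment, ← integral_complex_ofReal]
    simp only [Complex.ofReal_pow]
  simp only [hterm]
  refine hasSum_integral_of_dominated_convergence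
    (fun k _ => (‖z‖ * ‖y‖) ^ k / (Nat.factorial k : ℝ))
    (fun k => Continuous.aestronglyMeasurable (by fun_prop)) (fun k => .of_forall fun θ => ?_)
    (.of_forall fun _ => Real.summable_pow_div_factorial _) (integrable_const _)
    (.of_forall fun θ => ?_)
  · have hinner : |inner ℝ θ.1 y| ≤ ‖y‖ := by
      simpa [norm_eq_of_mem_sphere θ] using abs_real_inner_le_norm θ.1 y
    rw [norm_mul, norm_div, norm_pow, norm_pow, Complex.norm_real, Real.norm_eq_abs,
      Complex.norm_natCast, mul_pow, mul_div_right_comm]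
    gcongr
  · have h := NormedSpace.expSeries_div_hasSum_exp (𝔸 := ℂ) (z * (inner ℝ θ.1 y : ℝ))
    rw [← Complex.exp_eq_exp_ℂ] at h
    exact h.congr_fun fun k => by rw [mul_pow]; ring

/-- The moment `∫ ⟨x, y⟩^k e^{-|x|²} dx` of the Gaussian density; in polar coordinates it is a
Gamma factor times the moment of the sphere. -/
def gaussMoment (k : ℕ) (y : V) : ℝ := ∫ x : V, inner ℝ x y ^ k * Real.exp (-‖x‖ ^ 2)

theorem integrable_exp_mul_inner_mul_gauss (c : ℝ) (y : V) :
    Integrable fun x : V => Real.exp (c * inner ℝ x y) * Real.exp (-‖x‖ ^ 2) := by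
  refine (GaussianFourier.integrable_cexp_neg_mul_sq_norm_add (b := 1) (by simp) (c : ℂ)
    y).norm.congr (.of_forall fun x => ?_)
  simp only [Complex.norm_exp]
  rw [← Real.exp_add]
  congr 1
  rw [real_inner_comm]
  simp [← Complex.ofReal_pow]
  ring

theorem integral_exp_mul_inner_mul_gauss (c : ℝ) (y : V) :
    ∫ x : V, Real.exp (c * inner ℝ x y) * Real.exp (-‖x‖ ^ 2)
      = Real.pi ^ (Module.finrank ℝ V / 2 : ℝ) * Real.exp (c ^ 2 * ‖y‖ ^ 2 / 4) := by
  have h := GaussianFourier.integral_cexp_neg_mul_sq_norm_add (b := 1) (by simp) (c : ℂ) y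
  rw [← Complex.ofReal_inj, ← integral_complex_ofReal]
  convert h using 1
  · refine integral_congr_ae (.of_forall fun x => ?_)
    simp only
    rw [← Real.exp_add, real_inner_comm, Complex.ofReal_exp]
    push_cast
    ring_nf
  · push_cast [Complex.ofReal_cpow Real.pi_pos.le]
    simp

theorem integrable_exp_mul_abs_inner_mul_gauss (c : ℝ) (y : V) :
    Integrable fun x : V => Real.exp (c * |inner ℝ x y|) * Real.exp (-‖x‖ ^ 2) := by
  refine ((integrable_exp_mul_inner_mul_gauss c y).add
    (integrable_exp_mul_inner_mul_gauss (-c) y)).mono'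
    (Continuous.aestronglyMeasurable (by fun_prop)) (.of_forall fun x => ?_)
  rw [Real.norm_of_nonneg (by positivity), Pi.add_apply]
  rcases abs_cases (inner ℝ x y) with ⟨h, _⟩ | ⟨h, _⟩ <;> rw [h]
  · exact le_add_of_nonneg_right (by positivity)
  · rw [mul_neg, ← neg_mul]; exact le_add_of_nonneg_left (by positivity)

theorem integrable_inner_pow_mul_gauss (k : ℕ) (y : V) :
    Integrable fun x : V => inner ℝ x y ^ k * Real.exp (-‖x‖ ^ 2) := by
  refine ((integrable_exp_mul_abs_inner_mul_gauss 1 y).const_mul (Nat.factorial k : ℝ)).mono'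
    (Continuous.aestronglyMeasurable (by fun_prop)) (.of_forall fun x => ?_)
  have h := Real.pow_div_factorial_le_exp |inner ℝ x y| (abs_nonneg _) k
  rw [div_le_iff₀ (by positivity)] at h
  rw [norm_mul, norm_pow, Real.norm_eq_abs, Real.norm_of_nonneg (Real.exp_nonneg _), ← mul_assoc,
    one_mul, mul_comm (Nat.factorial k : ℝ)]
  gcongr

theorem hasSum_gaussMoment (c : ℝ) (y : V) :
    HasSum (fun k : ℕ => c ^ k * (gaussMoment k y / Nat.factorial k))
      (Real.pi ^ (Module.finrank ℝ V / 2 : ℝ) * Real.exp (c ^ 2 * ‖y‖ ^ 2 / 4)) := by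
  have hterm (k : ℕ) : c ^ k * (gaussMoment k y / Nat.factorial k)
      = ∫ x : V, (c * inner ℝ x y) ^ k / Nat.factorial k * Real.exp (-‖x‖ ^ 2) := by
    rw [gaussMoment, ← integral_div, ← integral_const_mul]
    congr 1 with x
    ring
  simp only [hterm, ← integral_exp_mul_inner_mul_gauss]
  refine hasSum_integral_of_dominated_convergence
    (fun k x => (|c| * |inner ℝ x y|) ^ k / (Nat.factorial k : ℝ) * Real.exp (-‖x‖ ^ 2))
    (fun k => Continuous.aestronglyMeasurable (by fun_prop))
    (fun k => .of_forall fun x => le_of_eq ?_)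
    (.of_forall fun x => (Real.summable_pow_div_factorial _).mul_right _)
    ((integrable_exp_mul_abs_inner_mul_gauss |c| y).congr (.of_forall fun x => ?_))
    (.of_forall fun x => ?_)
  · rw [norm_mul, norm_div, norm_pow, norm_mul, Real.norm_natCast, Real.norm_eq_abs,
      Real.norm_eq_abs, Real.norm_of_nonneg (Real.exp_nonneg _)]
  · simp only [tsum_mul_right]
    rw [Real.exp_eq_exp_ℝ, NormedSpace.exp_eq_tsum_div]
  · have h := NormedSpace.expSeries_div_hasSum_exp (𝔸 := ℝ) (c * inner ℝ x y)
    rw [← Real.exp_eq_exp_ℝ] at h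
    exact h.mul_right _

theorem eq_of_hasSum_pow_mul {𝕜 : Type*} [NontriviallyNormedField 𝕜] {a b : ℕ → 𝕜}
    {f : 𝕜 → 𝕜} (ha : ∀ z, HasSum (fun k => z ^ k * a k) (f z))
    (hb : ∀ z, HasSum (fun k => z ^ k * b k) (f z)) : a = b := by
  have hasFPowerSeries {a : ℕ → 𝕜} (ha : ∀ z, HasSum (fun k => z ^ k * a k) (f z)) :
      HasFPowerSeriesAt f (FormalMultilinearSeries.ofScalars 𝕜 a) 0 := by
    rw [hasFPowerSeriesAt_iff]
    refine .of_forall fun z => ?_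
    simpa [FormalMultilinearSeries.coeff_ofScalars] using ha z
  have h := (hasFPowerSeries ha).eq_formalMultilinearSeries (hasFPowerSeries hb)
  funext k
  simpa [FormalMultilinearSeries.coeff_ofScalars] using congrArg (·.coeff k) h

theorem gaussMoment_div_factorial (k : ℕ) (y : V) :
    gaussMoment k y / Nat.factorial k = if Even k then
      Real.pi ^ (Module.finrank ℝ V / 2 : ℝ) * ((‖y‖ ^ 2 / 4) ^ (k / 2) / Nat.factorial (k / 2))
      else 0 := by
  refine congrFun (eq_of_hasSum_pow_mul (fun c => hasSum_gaussMoment c y) (b := fun k =>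
    if Even k then
      Real.pi ^ (Module.finrank ℝ V / 2 : ℝ) * ((‖y‖ ^ 2 / 4) ^ (k / 2) / Nat.factorial (k / 2))
    else 0) fun c => ?_) k
  rw [← add_zero (_ * _)]
  refine HasSum.even_add_odd ?_ (by simp [hasSum_zero])
  have h := NormedSpace.expSeries_div_hasSum_exp (𝔸 := ℝ) (c ^ 2 * ‖y‖ ^ 2 / 4)
  rw [← Real.exp_eq_exp_ℝ] at h
  refine (h.mul_left _).congr_fun fun k => ?_
  simp only [even_two, Even.mul_right, if_true, Nat.mul_div_cancel_left k two_pos]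
  rw [mul_div_assoc (c ^ 2), mul_pow, ← pow_mul]
  ring

variable [Nontrivial V]

theorem gaussMoment_eq_sphereMoment_mul (k : ℕ) (y : V) :
    gaussMoment k y = sphereMoment k y * (Real.Gamma ((k + Module.finrank ℝ V) / 2) / 2) := by
  set n := Module.finrank ℝ V
  have hn : 0 < n := Module.finrank_pos
  have hGamma := integral_rpow_mul_exp_neg_rpow (p := 2) (q := (n - 1 + k : ℕ)) two_pos
    (neg_one_lt_zero.trans_le (Nat.cast_nonneg _))
  have hexp : (((n - 1 + k : ℕ) : ℝ) + 1) / 2 = (k + n) / 2 := by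
    rw [← Nat.cast_add_one, show n - 1 + k + 1 = k + n by omega, Nat.cast_add]
  rw [hexp, one_div_mul_eq_div] at hGamma
  rw [gaussMoment, integral_polar volume (integrable_inner_pow_mul_gauss k y), ← hGamma,
    ← integral_const_mul]
  refine setIntegral_congr_fun measurableSet_Ioi fun t ht => ?_
  have hpolar (θ : Metric.sphere (0 : V) 1) :
      inner ℝ (t • θ.1) y ^ k * Real.exp (-‖t • θ.1‖ ^ 2)
        = t ^ k * Real.exp (-t ^ 2) * inner ℝ θ.1 y ^ k := by
    rw [real_inner_smul_left, norm_smul, norm_eq_of_mem_sphere θ, Real.norm_of_nonneg (le_of_lt ht)]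
    ring_nf
  simp only [hpolar, integral_const_mul, smul_eq_mul, Real.rpow_natCast, Real.rpow_two,
    sphereMoment, pow_add, n]
  ring

theorem sphereMoment_two_mul (j : ℕ) (y : V) :
    sphereMoment (2 * j) y / Nat.factorial (2 * j)
      = 2 * Real.pi ^ (Module.finrank ℝ V / 2 : ℝ) * ((‖y‖ ^ 2 / 4) ^ j
        / (Nat.factorial j * Real.Gamma (Module.finrank ℝ V / 2 + j))) := by
  have hn : 0 < Module.finrank ℝ V := Module.finrank_pos
  have hΓ : Real.Gamma (Module.finrank ℝ V / 2 + j) ≠ 0 :=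
    (Real.Gamma_pos_of_pos (by positivity)).ne'
  have h := gaussMoment_div_factorial (2 * j) y
  rw [if_pos (even_two_mul j), Nat.mul_div_cancel_left j two_pos, gaussMoment_eq_sphereMoment_mul,
    show (((2 * j : ℕ) : ℝ) + Module.finrank ℝ V) / 2 = Module.finrank ℝ V / 2 + j by
      push_cast; ring] at h
  field_simp [hΓ] at h ⊢
  linear_combination h

theorem sphereMoment_of_odd {k : ℕ} (hk : Odd k) (y : V) : sphereMoment k y = 0 := by
  have hn : 0 < Module.finrank ℝ V := Module.finrank_pos
  have hΓ : 0 < Real.Gamma ((k + Module.finrank ℝ V) / 2) := Real.Gamma_pos_of_pos (by positivity)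
  have h := gaussMoment_div_factorial k y
  rw [if_neg (Nat.not_even_iff_odd.mpr hk), gaussMoment_eq_sphereMoment_mul] at h
  simpa [Nat.factorial_ne_zero, hΓ.ne'] using h

theorem integral_sphere_exp (t : ℝ) (y : V) :
    ∫ θ, Complex.exp (2 * Real.pi * Complex.I * t * (inner ℝ θ.1 y : ℝ))
        ∂(volume : Measure V).toSphere
      = (2 * Real.pi ^ (Module.finrank ℝ V / 2 : ℝ)
        * besselClifford (Module.finrank ℝ V / 2 - 1) (Real.pi ^ 2 * ‖y‖ ^ 2 * t ^ 2) : ℝ) := by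
  have hseries := hasSum_integral_sphere_exp (2 * Real.pi * Complex.I * t) y
  have heven := (Function.Injective.hasSum_iff (mul_right_injective₀ two_ne_zero)
    fun k hk => ?_).mpr hseries
  · have hbessel := Complex.hasSum_ofReal.mpr ((summable_besselClifford
      (Module.finrank ℝ V / 2 - 1) (Real.pi ^ 2 * ‖y‖ ^ 2 * t ^ 2)).hasSum.mul_left
      (2 * Real.pi ^ (Module.finrank ℝ V / 2 : ℝ)))
    refine heven.unique (hbessel.congr_fun fun j => ?_)
    have hz : (2 * Real.pi * Complex.I * t) ^ (2 * j)
        = (((-4 * Real.pi ^ 2 * t ^ 2) ^ j : ℝ) : ℂ) := by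
      rw [pow_mul, mul_pow, mul_pow, mul_pow, Complex.I_sq]
      push_cast; ring
    rw [Function.comp_apply, hz, ← Complex.ofReal_natCast, ← Complex.ofReal_div,
      ← Complex.ofReal_mul, div_mul_eq_mul_div, mul_div_assoc, sphereMoment_two_mul,
      besselCliffordCoeff, sub_add_eq_add_sub, sub_add_cancel]
    congr 1
    rw [show -4 * Real.pi ^ 2 * t ^ 2 = -1 * 4 * Real.pi ^ 2 * t ^ 2 by ring]
    simp only [mul_pow, div_pow]
    field
  · have hodd : Odd k := by
      by_contra h
      obtain ⟨j, rfl⟩ := even_iff_two_dvd.mp (Nat.not_odd_iff_even.mp h)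
      exact hk ⟨j, rfl⟩
    rw [sphereMoment_of_odd hodd, Complex.ofReal_zero, mul_zero]

theorem integral_radial_mul_exp {ψ : ℝ → ℂ} (hψ : Integrable fun x : V => ψ ‖x‖) (y : V) :
    ∫ x : V, ψ ‖x‖ * Complex.exp (2 * Real.pi * Complex.I * (inner ℝ x y : ℝ))
      = ∫ t in Ioi (0 : ℝ), ψ t * (2 * Real.pi ^ (Module.finrank ℝ V / 2 : ℝ)
        * t ^ (Module.finrank ℝ V - 1)
        * besselClifford (Module.finrank ℝ V / 2 - 1) (Real.pi ^ 2 * ‖y‖ ^ 2 * t ^ 2) : ℝ) := by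
  have hint : Integrable fun x : V =>
      ψ ‖x‖ * Complex.exp (2 * Real.pi * Complex.I * (inner ℝ x y : ℝ)) :=
    hψ.mul_bdd (c := 1) (Continuous.aestronglyMeasurable (by fun_prop))
      (.of_forall fun x => by simp [Complex.norm_exp])
  rw [integral_polar volume hint]
  refine setIntegral_congr_fun measurableSet_Ioi fun t ht => ?_
  have hpolar (θ : Metric.sphere (0 : V) 1) :
      ψ ‖t • θ.1‖ * Complex.exp (2 * Real.pi * Complex.I * (inner ℝ (t • θ.1) y : ℝ))
        = ψ t * Complex.exp (2 * Real.pi * Complex.I * t * (inner ℝ θ.1 y : ℝ)) := by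
    rw [norm_smul, norm_eq_of_mem_sphere θ, Real.norm_of_nonneg (le_of_lt ht), mul_one,
      real_inner_smul_left, Complex.ofReal_mul, mul_assoc _ (t : ℂ)]
  simp only [hpolar, integral_const_mul]
  rw [integral_sphere_exp t y, Complex.real_smul]
  push_cast
  ring

end SphereFourier

theorem integral_sq_sub_sq_pow_mul_deriv (k : ℕ) (τ : ℝ) {G G' : ℝ → ℝ}
    (hG : ∀ t, HasDerivAt G (G' t) t) (hG' : Continuous G') (h0 : G 0 = 0) :
    ∫ t in (0 : ℝ)..τ, (τ ^ 2 - t ^ 2) ^ (k + 1) / (Nat.factorial (k + 1) : ℝ) * G' t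
      = ∫ t in (0 : ℝ)..τ, (τ ^ 2 - t ^ 2) ^ k / (Nat.factorial k : ℝ) * (2 * t * G t) := by
  have hkernel (t : ℝ) : HasDerivAt
      (fun t : ℝ => (τ ^ 2 - t ^ 2) ^ (k + 1) / (Nat.factorial (k + 1) : ℝ))
      (-((τ ^ 2 - t ^ 2) ^ k / (Nat.factorial k : ℝ) * (2 * t))) t := by
    refine ((((hasDerivAt_pow 2 t).const_sub (τ ^ 2)).pow (k + 1)).div_const
      (Nat.factorial (k + 1) : ℝ)).congr_deriv ?_
    rw [Nat.factorial_succ]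
    push_cast
    simp only [pow_one]
    field_simp
  rw [intervalIntegral.integral_mul_deriv_eq_deriv_mul (fun t _ => hkernel t) (fun t _ => hG t)
    (Continuous.intervalIntegrable (by fun_prop) _ _) (hG'.intervalIntegrable _ _), h0, sub_self,
    zero_pow k.succ_ne_zero, zero_div, zero_mul, mul_zero, sub_zero, zero_sub,
    ← intervalIntegral.integral_neg]
  congr 1; funext t; ring

/-- Sonine's first finite integral: integrating by parts raises the order of the Bessel function
by one and lowers the exponent of `τ ^ 2 - t ^ 2` by one. -/
theorem integral_sq_sub_sq_pow_mul_besselClifford (k N : ℕ) (c τ : ℝ) :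
    ∫ t in (0 : ℝ)..τ, (τ ^ 2 - t ^ 2) ^ k / (Nat.factorial k : ℝ) *
        (2 * t ^ N * besselClifford ((N + 1) / 2 - 1) (c * t ^ 2))
      = τ ^ (N + 1 + 2 * k) * besselClifford ((N + 1) / 2 + k) (c * τ ^ 2) := by
  induction k generalizing N with
  | zero =>
    simp only [pow_zero, Nat.factorial_zero, Nat.cast_one, div_one, one_mul, mul_zero, add_zero,
      Nat.cast_zero]
    rw [intervalIntegral.integral_eq_sub_of_hasDerivAt
      (fun t _ => hasDerivAt_pow_mul_besselClifford N c t)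
      (Continuous.intervalIntegrable (by fun_prop) _ _), zero_pow N.succ_ne_zero, zero_mul,
      sub_zero]
  | succ k ih =>
    rw [integral_sq_sub_sq_pow_mul_deriv k τ (hasDerivAt_pow_mul_besselClifford N c)
      (by fun_prop) (by simp)]
    convert ih (N + 2) using 2
    · funext t
      rw [show (((N + 2 : ℕ) : ℝ) + 1) / 2 - 1 = (N + 1) / 2 by push_cast; ring]
      ring
    · ring
    · congr 1; push_cast; ring

theorem norm_e {d : ℕ} (ξ x : E d) : ‖e ξ x‖ = 1 := by
  rw [e, Complex.norm_exp]
  simp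

@[fun_prop]
theorem continuous_e_left {d : ℕ} (x : E d) : Continuous fun ξ : E d => e ξ x := by
  unfold e; fun_prop

section RieszMean

variable {d : ℕ}

theorem measurableSet_norm_sq_lt (s : ℝ) : MeasurableSet {ξ : E d | ‖ξ‖ ^ 2 < s} :=
  measurableSet_lt (by fun_prop) measurable_const

theorem norm_sq_lt_subset_closedBall (s : ℝ) :
    {ξ : E d | ‖ξ‖ ^ 2 < s} ⊆ Metric.closedBall 0 (Real.sqrt s) := fun _ hξ =>
  mem_closedBall_zero_iff.mpr (Real.lt_sqrt_of_sq_lt hξ).le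

theorem integrableOn_norm_sq_lt (s : ℝ) {f : E d → ℂ} (hf : Continuous f) :
    IntegrableOn f {ξ : E d | ‖ξ‖ ^ 2 < s} :=
  (hf.continuousOn.integrableOn_compact (isCompact_closedBall _ _)).mono_set
    (norm_sq_lt_subset_closedBall s)

theorem Dint_natCast (k : ℕ) (s : ℝ) (y : E d) :
    Dint k s y = ∫ ξ in {ξ : E d | ‖ξ‖ ^ 2 < s},
      (((s - ‖ξ‖ ^ 2) ^ k / (Nat.factorial k : ℝ) : ℝ) : ℂ) * e ξ y := by
  rw [Dint, Real.Gamma_nat_eq_factorial, ← integral_const_mul]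
  refine integral_congr_ae (.of_forall fun ξ => ?_)
  simp only [Real.rpow_natCast]
  push_cast
  ring

theorem Dint_eq_integral_Ioo [NeZero d] (k : ℕ) (s : ℝ) (y : E d) :
    Dint k s y = ∫ t in Ioo 0 (Real.sqrt s), (((s - t ^ 2) ^ k / (Nat.factorial k : ℝ) : ℝ) : ℂ) *
      (2 * Real.pi ^ (d / 2 : ℝ) * t ^ (d - 1) *
        besselClifford (d / 2 - 1) (Real.pi ^ 2 * ‖y‖ ^ 2 * t ^ 2) : ℝ) := by
  set ψ : ℝ → ℂ := {t : ℝ | t ^ 2 < s}.indicator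
    fun t => (((s - t ^ 2) ^ k / (Nat.factorial k : ℝ) : ℝ) : ℂ)
  have hradial : (fun x : E d => ψ ‖x‖) = {ξ : E d | ‖ξ‖ ^ 2 < s}.indicator
      fun ξ => (((s - ‖ξ‖ ^ 2) ^ k / (Nat.factorial k : ℝ) : ℝ) : ℂ) := rfl
  have hint : Integrable fun x : E d => ψ ‖x‖ := by
    rw [hradial, integrable_indicator_iff (measurableSet_norm_sq_lt s)]
    exact integrableOn_norm_sq_lt s (by fun_prop)
  have hDint : Dint k s y = ∫ x : E d, ψ ‖x‖ * e x y := by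
    rw [Dint_natCast, ← integral_indicator (measurableSet_norm_sq_lt s)]
    simp only [congrFun hradial, indicator_mul_left]
  have hset : Ioo 0 (Real.sqrt s) = Ioi 0 ∩ {t : ℝ | t ^ 2 < s} := by
    ext t
    exact and_congr_right fun ht => Real.lt_sqrt (le_of_lt ht)
  have hpolar := integral_radial_mul_exp hint y
  rw [finrank_euclideanSpace_fin] at hpolar
  rw [hDint, hset, ← setIntegral_indicator (measurableSet_lt (by fun_prop) measurable_const)]
  simp only [indicator_mul_left]
  exact hpolar

theorem Dint_eq_besselClifford [NeZero d] (k : ℕ) {s : ℝ} (hs : 0 ≤ s) (y : E d) :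
    Dint k s y = (Real.pi ^ (d / 2 : ℝ) * (Real.sqrt s ^ (d + 2 * k) *
      besselClifford (d / 2 + k) (Real.pi ^ 2 * ‖y‖ ^ 2 * s)) : ℝ) := by
  have hsonine := integral_sq_sub_sq_pow_mul_besselClifford k (d - 1) (Real.pi ^ 2 * ‖y‖ ^ 2)
    (Real.sqrt s)
  have hd : ((d - 1 : ℕ) : ℝ) + 1 = d := by
    exact_mod_cast Nat.sub_add_cancel NeZero.one_le
  rw [hd, Nat.sub_add_cancel NeZero.one_le, Real.sq_sqrt hs] at hsonine
  rw [Dint_eq_integral_Ioo, ← hsonine, ← intervalIntegral.integral_const_mul,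
    intervalIntegral.integral_of_le (Real.sqrt_nonneg s), integral_Ioc_eq_integral_Ioo,
    ← integral_complex_ofReal]
  refine integral_congr_ae (.of_forall fun t => ?_)
  push_cast
  ring

theorem continuousOn_Dint [NeZero d] (k : ℕ) (y : E d) :
    ContinuousOn (fun s => Dint k s y) (Ici 0) :=
  Continuous.continuousOn (by fun_prop) |>.congr fun _ hs => Dint_eq_besselClifford k hs y

/-- The summand `1 / 2` in the exponent comes from `J_ν(r) = O(r ^ (-1 / 2))`. -/
theorem exists_norm_Dint_le_rpow [NeZero d] (k : ℕ) (L : ℝ) :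
    ∃ C : ℝ, ∀ s ∈ Icc 0 L, ∀ y : E d, y ≠ 0 →
      ‖Dint k s y‖ ≤ C * ‖y‖ ^ (-(d / 2 + k + 1 / 2 : ℝ)) := by
  have hd : (1 : ℝ) ≤ d := by exact_mod_cast NeZero.one_le
  set ν : ℝ := d / 2 + k with hν
  have hν₁ : 1 / 2 ≤ ν := by have : (0 : ℝ) ≤ k := k.cast_nonneg; linarith
  obtain ⟨C, hC⟩ := exists_rpow_mul_besselClifford_bound (ν := ν) (by linarith)
  refine ⟨Real.pi ^ (d / 2 : ℝ) * (Real.sqrt L ^ (ν - 1 / 2) * (C * Real.pi ^ (-(ν + 1 / 2)))),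
    fun s hs y hy => ?_⟩
  have hy' : 0 < ‖y‖ := norm_pos_iff.mpr hy
  have hτ : 0 ≤ Real.sqrt s := Real.sqrt_nonneg s
  have hscale : Real.sqrt s ^ (d + 2 * k) = Real.sqrt s ^ (ν - 1 / 2) *
      ((Real.pi * ‖y‖ * Real.sqrt s) ^ (ν + 1 / 2) *
        (Real.pi ^ (-(ν + 1 / 2)) * ‖y‖ ^ (-(ν + 1 / 2)))) := by
    rw [Real.mul_rpow (by positivity) hτ, Real.mul_rpow Real.pi_pos.le hy'.le,
      Real.rpow_neg Real.pi_pos.le, Real.rpow_neg hy'.le, ← Real.rpow_natCast,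
      show ((d + 2 * k : ℕ) : ℝ) = (ν - 1 / 2) + (ν + 1 / 2) by push_cast [hν]; ring,
      Real.rpow_add_of_nonneg hτ (by linarith) (by linarith)]
    field_simp
  rw [Dint_eq_besselClifford k hs.1, Complex.norm_real, Real.norm_eq_abs, hscale]
  have : 0 ≤ C := (abs_nonneg _).trans (hC 0 le_rfl)
  have hbessel := hC (Real.pi * ‖y‖ * Real.sqrt s) (by positivity)
  rw [mul_pow, mul_pow, Real.sq_sqrt hs.1] at hbessel
  calc _ = Real.pi ^ (d / 2 : ℝ) * (Real.sqrt s ^ (ν - 1 / 2) *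
        (|(Real.pi * ‖y‖ * Real.sqrt s) ^ (ν + 1 / 2) *
          besselClifford ν (Real.pi ^ 2 * ‖y‖ ^ 2 * s)| * Real.pi ^ (-(ν + 1 / 2)))) *
            ‖y‖ ^ (-(ν + 1 / 2)) := by
        simp only [abs_mul, abs_of_nonneg, Real.rpow_nonneg, Real.pi_pos.le, norm_nonneg, hτ]
        ring
    _ ≤ _ := by gcongr; exact hs.2

end RieszMean

theorem integrable_tsum_of_summable_integral_norm {α ι G : Type*} [Countable ι]
    [MeasurableSpace α] {μ : Measure α} [NormedAddCommGroup G] [CompleteSpace G] {F : ι → α → G}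
    (hF : ∀ i, Integrable (F i) μ) (hsum : Summable fun i => ∫ a, ‖F i a‖ ∂μ) :
    Integrable (fun a => ∑' i, F i a) μ := by
  have hlint : ∫⁻ a, ∑' i, ‖F i a‖ₑ ∂μ < ⊤ := by
    rw [lintegral_tsum fun i => (hF i).1.enorm]
    simp_rw [← ofReal_integral_norm_eq_lintegral_enorm (hF _)]
    exact hsum.tsum_ofReal_lt_top
  have hsummable : ∀ᵐ a ∂μ, Summable fun i => F i a := by
    filter_upwards [ae_lt_top' (.tsum fun i => (hF i).1.enorm) hlint.ne] with a ha
    exact .of_enorm ha.ne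
  refine ⟨aestronglyMeasurable_of_tendsto_ae Filter.atTop
    (f := fun s : Finset ι => fun a => ∑ i ∈ s, F i a)
    (fun s => Finset.aestronglyMeasurable_fun_sum s fun i _ => (hF i).1) ?_, ?_⟩
  · filter_upwards [hsummable] with a ha using ha.hasSum
  · exact (lintegral_mono fun a => enorm_tsum_le_tsum_enorm).trans_lt hlint

theorem fourier_eq_integral_mul_e {d : ℕ} (F : E d → ℂ) (ξ : E d) :
    𝓕 F ξ = ∫ x, F x * e (-ξ) x := by
  rw [Real.fourier_eq']
  refine integral_congr_ae (.of_forall fun x => ?_)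
  simp only [e, smul_eq_mul, inner_neg_left]
  rw [mul_comm, real_inner_comm]
  congr 2
  push_cast; ring

section Lattice

variable {d : ℕ}

theorem latt_apply (m : Fin d → ℤ) (i : Fin d) : latt m i = m i := rfl

theorem latt_zero : latt (0 : Fin d → ℤ) = 0 := by
  ext i; simp [latt_apply]

theorem latt_add (m n : Fin d → ℤ) : latt (m + n) = latt m + latt n := by
  ext i; simp [latt_apply]

theorem latt_neg (m : Fin d → ℤ) : latt (-m) = -latt m := by
  ext i; simp [latt_apply]

theorem latt_injective : Function.Injective (latt (d := d)) := fun m n h =>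
  funext fun i => by simpa [latt_apply] using congrArg (fun v : E d => v i) h

theorem e_neg_latt_add_latt (m n : Fin d → ℤ) (x : E d) :
    e (-latt m) (x + latt n) = e (-latt m) x := by
  have hinner : inner ℝ (latt m) (latt n) = ((∑ i, m i * n i : ℤ) : ℝ) := by
    simp [PiLp.inner_apply, latt_apply, mul_comm]
  simp only [e, inner_add_right, inner_neg_left, hinner]
  rw [Complex.exp_eq_exp_iff_exists_int]
  exact ⟨-∑ i, m i * n i, by push_cast; ring⟩

theorem measurableSet_torus (d : ℕ) : MeasurableSet (torus d) := by
  simp only [torus, ofPred_forall]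
  exact .iInter fun i => measurableSet_Ioc.preimage (by fun_prop)

theorem existsUnique_sub_latt_mem_torus (x : E d) : ∃! m : Fin d → ℤ, x - latt m ∈ torus d := by
  have hcoord (i : Fin d) : ∃! k : ℤ, x i - k ∈ Ioc (-(1 / 2) : ℝ) (1 / 2) := by
    have h := existsUnique_sub_zsmul_mem_Ioc (one_pos (α := ℝ)) (x i) (-(1 / 2))
    norm_num at h ⊢
    exact h
  choose k hk hunique using hcoord
  exact ⟨k, hk, fun m hm => funext fun i => hunique i (m i) (hm i)⟩

theorem hasSum_setIntegral_torus {G : Type*} [NormedAddCommGroup G] [NormedSpace ℝ G]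
    {F : E d → G} (hF : Integrable F) :
    HasSum (fun n : Fin d → ℤ => ∫ x in torus d, F (x + latt n)) (∫ x, F x) := by
  have hmeas (n : Fin d → ℤ) : MeasurableSet ((· - latt n) ⁻¹' torus d) :=
    (measurableSet_torus d).preimage (by fun_prop)
  have hcover : (⋃ n : Fin d → ℤ, (· - latt n) ⁻¹' torus d) = univ :=
    eq_univ_of_forall fun x => mem_iUnion.mpr (existsUnique_sub_latt_mem_torus x).exists
  have hdisjoint : Pairwise (Function.onFun Disjoint fun n : Fin d → ℤ =>
      (· - latt n) ⁻¹' torus d) :=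
    fun m n hmn => Set.disjoint_left.mpr fun x hxm hxn =>
      hmn ((existsUnique_sub_latt_mem_torus x).unique hxm hxn)
  have h := hasSum_integral_iUnion (μ := volume) hmeas hdisjoint hF.integrableOn
  rw [hcover, setIntegral_univ] at h
  refine h.congr_fun fun n => ?_
  rw [← (measurePreserving_add_right volume (latt n)).setIntegral_preimage_emb
    (MeasurableEquiv.addRight (latt n)).measurableEmbedding F, ← preimage_comp]
  simp [Function.comp_def]

theorem summable_setIntegral_torus_norm {F : E d → ℂ} (hF : Integrable F) :
    Summable fun n : Fin d → ℤ => ∫ x in torus d, ‖F (x + latt n)‖ :=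
  (hasSum_setIntegral_torus hF.norm).summable

theorem integrableOn_periodization {F : E d → ℂ} (hF : Integrable F) :
    IntegrableOn (periodization F) (torus d) :=
  integrable_tsum_of_summable_integral_norm
    (fun n => (hF.comp_add_right (latt n)).integrableOn) (summable_setIntegral_torus_norm hF)

theorem hasSum_integral_periodization {F : E d → ℂ} (hF : Integrable F) :
    HasSum (fun n : Fin d → ℤ => ∫ x in torus d, F (x + latt n))
      (∫ x in torus d, periodization F x) :=
  hasSum_integral_of_summable_integral_norm
    (fun n => (hF.comp_add_right (latt n)).integrableOn) (summable_setIntegral_torus_norm hF)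

theorem periodization_mul_e (F : E d → ℂ) (m : Fin d → ℤ) (x : E d) :
    periodization F x * e (-latt m) x = periodization (fun y => F y * e (-latt m) y) x := by
  simp only [periodization, e_neg_latt_add_latt, tsum_mul_right]

theorem fourierCoefficient_periodization {F : E d → ℂ} (hF : Integrable F) (m : Fin d → ℤ) :
    fourierCoefficient (periodization F) m = 𝓕 F (latt m) := by
  have he : Continuous fun x => e (-latt m) x := by unfold e; fun_prop
  have hFe : Integrable fun x => F x * e (-latt m) x :=
    hF.mul_bdd (c := 1) he.aestronglyMeasurable (.of_forall fun x => (norm_e _ _).le)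
  rw [fourier_eq_integral_mul_e, fourierCoefficient]
  simp only [periodization_mul_e]
  exact (hasSum_integral_periodization hFe).unique (hasSum_setIntegral_torus hFe)

theorem periodization_add_latt (F : E d → ℂ) (x : E d) (n : Fin d → ℤ) :
    periodization F (x + latt n) = periodization F x := by
  rw [periodization, periodization, ← (Equiv.addLeft n).tsum_eq fun m => F (x + latt m)]
  simp [latt_add, add_assoc]

theorem continuous_periodization {F : E d → ℂ} (hF : Continuous F) (hsupp : HasCompactSupport F) :
    Continuous (periodization F) := by
  obtain ⟨R, hR⟩ := hsupp.isCompact.isBounded.subset_closedBall 0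
  refine continuous_iff_continuousAt.mpr fun x => ?_
  have hfinite : (fun y => ∑ m ∈ (finite_norm_lt d (R + ‖x‖ + 2)).toFinset, F (y + latt m))
      =ᶠ[nhds x] periodization F := by
    filter_upwards [Metric.ball_mem_nhds x one_pos] with y hy
    refine (tsum_eq_sum fun m hm => image_eq_zero_of_notMem_tsupport fun hmem => hm ?_).symm
    have hym := mem_closedBall_zero_iff.mp (hR hmem)
    have hmy := norm_sub_le (y + latt m) y
    have hyx := norm_sub_norm_le y x
    rw [mem_ball_iff_norm] at hy
    rw [add_sub_cancel_left] at hmy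
    rw [Finite.mem_toFinset, mem_ofPred_eq]
    linarith
  exact (Continuous.continuousAt (by fun_prop)).congr hfinite

/-- The quotient map `ℝ^d → ℝ^d / ℤ^d`, with values in Mathlib's model of the torus, to which
periodizations descend. -/
def toUnitAddTorus (d : ℕ) : C(E d, UnitAddTorus (Fin d)) where
  toFun x i := (x i : ℝ)
  continuous_toFun := by fun_prop

theorem isQuotientMap_toUnitAddTorus (d : ℕ) : Topology.IsQuotientMap (toUnitAddTorus d) :=
  ((IsOpenQuotientMap.piMap fun _ : Fin d => QuotientAddGroup.isOpenQuotientMap_mk).comp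
    (PiLp.homeomorph 2 fun _ : Fin d => ℝ).isOpenQuotientMap).isQuotientMap

theorem exists_eq_add_latt_of_toUnitAddTorus_eq {x y : E d}
    (h : toUnitAddTorus d x = toUnitAddTorus d y) : ∃ n : Fin d → ℤ, x = y + latt n := by
  have hcoord (i : Fin d) : ∃ k : ℤ, x i = y i + k := by
    have hi : ((x i : ℝ) : UnitAddCircle) = (y i : ℝ) := congrFun h i
    rw [← sub_eq_zero, ← AddCircle.coe_sub, AddCircle.coe_eq_zero_iff] at hi
    obtain ⟨k, hk⟩ := hi
    exact ⟨k, by rw [zsmul_eq_mul, mul_one] at hk; linarith⟩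
  choose n hn using hcoord
  exact ⟨n, by ext i; simp [hn i, latt_apply]⟩

theorem mFourier_toUnitAddTorus (m : Fin d → ℤ) (x : E d) :
    UnitAddTorus.mFourier m (toUnitAddTorus d x) = e (latt m) x := by
  simp only [UnitAddTorus.mFourier, ContinuousMap.coe_mk, toUnitAddTorus, fourier_coe_apply, e,
    PiLp.inner_apply, latt_apply]
  rw [← Complex.exp_sum]
  push_cast
  rw [Finset.mul_sum]
  congr 1
  refine Finset.sum_congr rfl fun i _ => ?_
  simp
  ring

theorem mFourierCoeff_eq_fourierCoefficient (f : UnitAddTorus (Fin d) → ℂ) (m : Fin d → ℤ) :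
    UnitAddTorus.mFourierCoeff f m = fourierCoefficient (f ∘ toUnitAddTorus d) m := by
  have hset : {x : Fin d → ℝ | ∀ i, x i ∈ Ioc (-(1 / 2) : ℝ) (-(1 / 2) + 1)} =
      WithLp.toLp 2 ⁻¹' torus d := by
    ext x
    norm_num [torus]
  rw [UnitAddTorus.mFourierCoeff_eq_integral f m fun _ => -(1 / 2), fourierCoefficient, hset,
    ← (PiLp.volume_preserving_toLp (Fin d)).setIntegral_preimage_emb
      (MeasurableEquiv.toLp 2 _).measurableEmbedding]
  refine integral_congr_ae (.of_forall fun x => ?_)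
  simp only [← latt_neg, ← mFourier_toUnitAddTorus, smul_eq_mul, Function.comp_apply, mul_comm]
  rfl

theorem hasSum_fourierCoefficient {P : E d → ℂ} (hP : Continuous P)
    (hper : ∀ x n, P (x + latt n) = P x) (hsum : Summable (fourierCoefficient P)) :
    HasSum (fourierCoefficient P) (P 0) := by
  have hfactors : Function.FactorsThrough (⟨P, hP⟩ : C(E d, ℂ)) (toUnitAddTorus d) :=
    fun x y hxy => by
      obtain ⟨n, rfl⟩ := exists_eq_add_latt_of_toUnitAddTorus_eq hxy
      exact hper y n
  set f := (isQuotientMap_toUnitAddTorus d).lift ⟨P, hP⟩ hfactors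
  have hf : f ∘ toUnitAddTorus d = P :=
    congrArg DFunLike.coe ((isQuotientMap_toUnitAddTorus d).lift_comp ⟨P, hP⟩ hfactors)
  have hcoeff (m : Fin d → ℤ) : UnitAddTorus.mFourierCoeff f m = fourierCoefficient P m := by
    rw [mFourierCoeff_eq_fourierCoefficient, hf]
  have h := UnitAddTorus.hasSum_mFourier_series_apply_of_summable (f := f)
    (hsum.congr fun m => (hcoeff m).symm) (toUnitAddTorus d 0)
  have hf₀ : f (toUnitAddTorus d 0) = P 0 := congrFun hf 0
  simpa [hcoeff, hf₀, mFourier_toUnitAddTorus, e] using h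

theorem hasSum_fourier_latt {F : E d → ℂ} (hF : Continuous F) (hsupp : HasCompactSupport F)
    (hsum : Summable fun m : Fin d → ℤ => 𝓕 F (latt m)) :
    HasSum (fun m : Fin d → ℤ => 𝓕 F (latt m)) (∑' m : Fin d → ℤ, F (latt m)) := by
  have hcoeff : fourierCoefficient (periodization F) = fun m => 𝓕 F (latt m) :=
    funext (fourierCoefficient_periodization (hF.integrable_of_hasCompactSupport hsupp))
  have h := hasSum_fourierCoefficient (continuous_periodization hF hsupp)
    (periodization_add_latt F) (hcoeff ▸ hsum)
  simpa only [hcoeff, periodization, zero_add] using h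

end Lattice

/-- The truncated power `(s - v)₊ ^ k / k!`, the kernel of a Riesz mean of order `k`. It is used
for `k ≠ 0` only: the convention `0 ^ 0 = 1` makes it equal to `1` everywhere for `k = 0`. -/
def truncPow (k : ℕ) (s v : ℝ) : ℝ := max (s - v) 0 ^ k / (Nat.factorial k : ℝ)

theorem truncPow_of_le {k : ℕ} {s v : ℝ} (h : v ≤ s) :
    truncPow k s v = (s - v) ^ k / (Nat.factorial k : ℝ) := by
  rw [truncPow, max_eq_left (sub_nonneg.mpr h)]

theorem truncPow_of_ge {k : ℕ} (hk : k ≠ 0) {s v : ℝ} (h : s ≤ v) : truncPow k s v = 0 := by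
  rw [truncPow, max_eq_right (sub_nonpos.mpr h), zero_pow hk, zero_div]

@[fun_prop]
theorem continuous_truncPow {X : Type*} [TopologicalSpace X] (k : ℕ) {f g : X → ℝ}
    (hf : Continuous f) (hg : Continuous g) : Continuous fun x => truncPow k (f x) (g x) := by
  unfold truncPow; fun_prop

section RieszMean

variable {d : ℕ}

theorem Dsum_natCast (k : ℕ) (s : ℝ) (x : E d) :
    Dsum k s x = ∑ m ∈ (finite_norm_sq_lt d s).toFinset,
      (((s - ‖latt m‖ ^ 2) ^ k / (Nat.factorial k : ℝ) : ℝ) : ℂ) * e (latt m) x := by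
  rw [Dsum, Real.Gamma_nat_eq_factorial, Finset.mul_sum]
  refine Finset.sum_congr rfl fun m _ => ?_
  rw [Real.rpow_natCast]
  push_cast
  ring

theorem Dsum_eq_sum_truncPow {k : ℕ} (hk : k ≠ 0) {s L : ℝ} (hs : s ≤ L) (x : E d) :
    Dsum k s x = ∑ m ∈ (finite_norm_sq_lt d L).toFinset,
      (truncPow k s (‖latt m‖ ^ 2) : ℂ) * e (latt m) x := by
  rw [Dsum_natCast]
  refine (Finset.sum_congr rfl fun m hm => ?_).trans (Finset.sum_subset ?_ fun m _ hm => ?_)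
  · rw [truncPow_of_le (le_of_lt (by simpa using hm))]
  · exact Finite.toFinset_subset_toFinset.mpr fun m hm => lt_of_lt_of_le hm hs
  · rw [truncPow_of_ge hk (by simpa using hm), Complex.ofReal_zero, zero_mul]

theorem Dint_eq_setIntegral_truncPow {k : ℕ} (hk : k ≠ 0) {s L : ℝ} (hs : s ≤ L) (y : E d) :
    Dint k s y = ∫ ξ in {ξ : E d | ‖ξ‖ ^ 2 < L}, (truncPow k s (‖ξ‖ ^ 2) : ℂ) * e ξ y := by
  rw [Dint_natCast, setIntegral_congr_fun (measurableSet_norm_sq_lt s)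
    (g := fun ξ => (truncPow k s (‖ξ‖ ^ 2) : ℂ) * e ξ y)]
  · refine (setIntegral_eq_of_subset_of_forall_sdiff_eq_zero (measurableSet_norm_sq_lt L)
      (fun ξ hξ => lt_of_lt_of_le hξ hs) fun ξ hξ => ?_).symm
    rw [truncPow_of_ge hk (not_lt.mp hξ.2), Complex.ofReal_zero, zero_mul]
  · intro ξ hξ
    simp only [truncPow_of_le (le_of_lt hξ)]

theorem continuousOn_Dsum {k : ℕ} (hk : k ≠ 0) (x : E d) (L : ℝ) :
    ContinuousOn (fun s => Dsum k s x) (Iic L) :=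
  Continuous.continuousOn (by fun_prop) |>.congr fun _ hs => Dsum_eq_sum_truncPow hk hs x

theorem summable_norm_sub_latt_rpow {p : ℝ} (hp : (d : ℝ) < p) (x : E d) :
    Summable fun m : Fin d → ℤ => ‖x - latt m‖ ^ (-p) := by
  set b := (EuclideanSpace.basisFun (Fin d) ℝ).toBasis
  set Λ : Submodule ℤ (E d) := Submodule.span ℤ (range b)
  have hrank : Module.finrank ℤ Λ = d := by
    rw [ZLattice.rank ℝ Λ, finrank_euclideanSpace_fin]
  have hmem (m : Fin d → ℤ) : latt m ∈ Λ := by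
    have hlatt : latt m = ∑ i, m i • b i := by
      ext j
      simp [b, latt_apply, Finset.sum_apply, Pi.single_apply]
    rw [hlatt]
    exact Submodule.sum_mem _ fun i _ => Submodule.smul_mem _ _ (Submodule.subset_span ⟨i, rfl⟩)
  have hinj : Function.Injective fun m : Fin d → ℤ => (⟨latt m, hmem m⟩ : Λ) := fun m n hmn =>
    latt_injective (congrArg Subtype.val hmn)
  have hsum := ZLattice.summable_norm_sub_rpow Λ (-p) (by rw [hrank]; linarith) x
  exact (hsum.comp_injective hinj).congr fun m => by simp [norm_sub_rev x]

variable {k : ℕ}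

theorem natCast_lt_half_add (hk : d ≤ 2 * k) : (d : ℝ) < d / 2 + k + 1 / 2 := by
  have : (d : ℝ) ≤ 2 * k := by exact_mod_cast hk
  linarith

variable [NeZero d]

theorem exists_summable_norm_Dint_le (hk : d ≤ 2 * k) (L : ℝ) (x : E d) :
    ∃ b : (Fin d → ℤ) → ℝ, Summable b ∧
      ∀ m, ∀ s ∈ Icc 0 L, ‖Dint k s (x - latt m)‖ ≤ b m := by
  classical
  obtain ⟨C, hC⟩ := exists_norm_Dint_le_rpow (d := d) k L
  obtain ⟨C₀, hC₀⟩ := isCompact_Icc.exists_bound_of_continuousOn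
    ((continuousOn_Dint k (0 : E d)).mono (Icc_subset_Ici_self : Icc 0 L ⊆ _))
  refine ⟨fun m => if x - latt m = 0 then C₀ else C * ‖x - latt m‖ ^ (-(d / 2 + k + 1 / 2 : ℝ)),
    ?_, fun m s hs => ?_⟩
  · have hfin : {m : Fin d → ℤ | x - latt m = 0}.Finite := by
      refine Set.Subsingleton.finite fun m hm n hn => latt_injective ?_
      rw [← sub_eq_zero.mp hm, ← sub_eq_zero.mp hn]
    refine ((summable_norm_sub_latt_rpow (natCast_lt_half_add hk) x).mul_left C).congr_cofinite ?_
    filter_upwards [hfin.compl_mem_cofinite] with m hm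
    exact (if_neg hm).symm
  · dsimp only
    split_ifs with hm
    · rw [hm]
      exact hC₀ s hs
    · exact hC s hs _ hm

theorem hasSum_Dint (hk : d ≤ 2 * k) {s : ℝ} (hs : 0 ≤ s) (x : E d) :
    HasSum (fun m : Fin d → ℤ => Dint k s (x - latt m)) (Dsum k s x) := by
  have hk0 : k ≠ 0 := by have := NeZero.ne d; omega
  set F : E d → ℂ := fun ξ => (truncPow k s (‖ξ‖ ^ 2) : ℂ) * e ξ x
  have hzero (ξ : E d) (hξ : ¬‖ξ‖ ^ 2 < s) : F ξ = 0 := by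
    simp only [F, truncPow_of_ge hk0 (not_lt.mp hξ), Complex.ofReal_zero, zero_mul]
  have hsupp : HasCompactSupport F :=
    .of_support_subset_isCompact (isCompact_closedBall 0 (Real.sqrt s)) fun ξ hξ =>
      norm_sq_lt_subset_closedBall s (not_not.mp (mt (hzero ξ) hξ))
  have hfourier (m : Fin d → ℤ) : 𝓕 F (latt m) = Dint k s (x - latt m) := by
    rw [fourier_eq_integral_mul_e, Dint_eq_setIntegral_truncPow hk0 le_rfl,
      ← setIntegral_eq_integral_of_forall_compl_eq_zero (s := {ξ : E d | ‖ξ‖ ^ 2 < s})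
        fun ξ hξ => by rw [hzero ξ hξ, zero_mul]]
    refine integral_congr_ae (.of_forall fun ξ => ?_)
    simp only [F, e, inner_sub_right, inner_neg_left, real_inner_comm ξ (latt m), mul_assoc,
      ← Complex.exp_add]
    push_cast
    ring_nf
  have htsum : ∑' m : Fin d → ℤ, F (latt m) = Dsum k s x := by
    rw [Dsum_eq_sum_truncPow hk0 le_rfl, tsum_eq_sum (s := (finite_norm_sq_lt d s).toFinset)]
    exact fun m hm => hzero _ (by simpa using hm)
  have hpoisson := hasSum_fourier_latt (F := F) (by fun_prop) hsupp
  simp only [hfourier, htsum] at hpoisson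
  obtain ⟨b, hb, hDint⟩ := exists_summable_norm_Dint_le hk s x
  exact hpoisson (.of_norm_bounded hb fun m => hDint m s ⟨hs, le_rfl⟩)

theorem hasSum_Dint_ne_zero (hk : d ≤ 2 * k) {s : ℝ} (hs : 0 ≤ s) (x : E d) :
    HasSum (fun m : {m : Fin d → ℤ // m ≠ 0} => Dint k s (x - latt m.1)) (Delta k s x) := by
  have h := hasSum_ite_sub_hasSum (hasSum_Dint hk hs x) 0
  rw [latt_zero, sub_zero] at h
  refine (hasSum_subtype_iff_indicator (s := {m : Fin d → ℤ | m ≠ 0})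
    (f := fun m => Dint k s (x - latt m))).mpr (h.congr_fun fun m => ?_)
  by_cases hm : m = 0 <;> simp [hm, indicator]

end RieszMean

section Taylor

variable {g : ℝ → ℂ} {k : ℕ} {L : ℝ}

theorem continuousOn_iteratedDerivWithin_Ici (hg : ContDiffOn ℝ ∞ g (Ici 0)) (j : ℕ) :
    ContinuousOn (iteratedDerivWithin j g (Ici 0)) (Ici 0) :=
  hg.continuousOn_iteratedDerivWithin (by exact_mod_cast le_top) (uniqueDiffOn_Ici 0)

theorem intervalIntegrable_mul_iteratedDerivWithin (hg : ContDiffOn ℝ ∞ g (Ici 0)) (hL : 0 ≤ L)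
    {f : ℝ → ℂ} (hf : ContinuousOn f (Icc 0 L)) (j : ℕ) :
    IntervalIntegrable (fun s => f s * iteratedDerivWithin j g (Ici 0) s) volume 0 L := by
  rw [← uIcc_of_le hL] at hf
  refine (hf.mul ((continuousOn_iteratedDerivWithin_Ici hg j).mono ?_)).intervalIntegrable
  rw [uIcc_of_le hL]
  exact Icc_subset_Ici_self

theorem taylor_Ici (hg : ContDiffOn ℝ ∞ g (Ici 0)) (k : ℕ) {v : ℝ} (hv : 0 ≤ v) (hvL : v < L) :
    g v = ∑ j ∈ Finset.range (k + 1), (-1) ^ j *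
        (((L - v) ^ j / (Nat.factorial j : ℝ) : ℝ) : ℂ) * iteratedDerivWithin j g (Ici 0) L
      + (-1) ^ (k + 1) * ∫ s in v..L, (((s - v) ^ k / (Nat.factorial k : ℝ) : ℝ) : ℂ) *
          iteratedDerivWithin (k + 1) g (Ici 0) s := by
  have hsub : uIcc L v ⊆ Ici 0 := by
    rw [uIcc_of_ge hvL.le]
    exact fun t ht => hv.trans ht.1
  have hderiv (j : ℕ) {t : ℝ} (ht : t ∈ uIcc L v) :
      iteratedDerivWithin j g (uIcc L v) t = iteratedDerivWithin j g (Ici 0) t := by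
    simp only [iteratedDerivWithin]
    rw [iteratedFDerivWithin_subset hsub (uniqueDiffOn_uIcc hvL.ne') (uniqueDiffOn_Ici 0)
      (hg.of_le (by exact_mod_cast le_top)) ht]
  have htaylor := taylor_integral_remainder (n := k)
    ((hg.of_le (by exact_mod_cast le_top)).mono hsub)
  rw [sub_eq_iff_eq_add', taylor_within_apply] at htaylor
  rw [htaylor, intervalIntegral.integral_symm, ← intervalIntegral.integral_neg,
    ← intervalIntegral.integral_const_mul]
  congr 1
  · refine Finset.sum_congr rfl fun j _ => ?_
    rw [hderiv j left_mem_uIcc, Complex.real_smul, ← neg_sub L v, neg_pow]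
    push_cast
    ring
  · refine intervalIntegral.integral_congr fun s hs => ?_
    rw [uIcc_comm] at hs
    simp only [hderiv _ hs, Complex.real_smul, ← neg_sub s v, neg_pow (s - v)]
    push_cast
    ring

theorem integral_truncPow_mul (hg : ContDiffOn ℝ ∞ g (Ici 0)) (hk : k ≠ 0) {v : ℝ} (hv : 0 ≤ v)
    (hvL : v ≤ L) :
    ∫ s in (0 : ℝ)..L, (truncPow k s v : ℂ) * iteratedDerivWithin (k + 1) g (Ici 0) s =
      ∫ s in v..L, (((s - v) ^ k / (Nat.factorial k : ℝ) : ℝ) : ℂ) *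
        iteratedDerivWithin (k + 1) g (Ici 0) s := by
  have hint := intervalIntegrable_mul_iteratedDerivWithin hg (hv.trans hvL)
    (f := fun s => (truncPow k s v : ℂ)) (Continuous.continuousOn (by fun_prop)) (k + 1)
  have hvL' : v ∈ uIcc 0 L := by rw [uIcc_of_le (hv.trans hvL)]; exact ⟨hv, hvL⟩
  have hzero : ∫ s in (0 : ℝ)..v, (truncPow k s v : ℂ) *
      iteratedDerivWithin (k + 1) g (Ici 0) s = 0 := by
    rw [intervalIntegral.integral_congr (g := fun _ => (0 : ℂ)), intervalIntegral.integral_zero]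
    intro s hs
    rw [uIcc_of_le hv] at hs
    simp only [truncPow_of_ge hk hs.2, Complex.ofReal_zero, zero_mul]
  rw [← intervalIntegral.integral_add_adjacent_intervals
    (hint.mono_set (uIcc_subset_uIcc left_mem_uIcc hvL'))
    (hint.mono_set (uIcc_subset_uIcc hvL' right_mem_uIcc)), hzero, zero_add]
  refine intervalIntegral.integral_congr fun s hs => ?_
  rw [uIcc_of_le hvL] at hs
  simp only [truncPow_of_le hs.1]

variable {X : Type*} [MeasurableSpace X] {ρ : Measure X} {v : X → ℝ} {w : X → ℂ}

theorem norm_truncPow_le {s v : ℝ} (hv : 0 ≤ v) (hs : s ∈ Icc 0 L) :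
    ‖(truncPow k s v : ℂ)‖ ≤ L ^ k / (Nat.factorial k : ℝ) := by
  have hmax : max (s - v) 0 ≤ L := max_le (by linarith [hs.2]) (hs.1.trans hs.2)
  rw [Complex.norm_real, Real.norm_eq_abs, truncPow, abs_of_nonneg (by positivity)]
  gcongr

theorem integrable_truncPow_mul_prod (hg : ContDiffOn ℝ ∞ g (Ici 0)) (hL : 0 ≤ L)
    (hv : Measurable v) (hv₀ : ∀ x, 0 ≤ v x) (hw : Integrable w ρ) (k : ℕ) :
    Integrable (Function.uncurry fun x s => (truncPow k s (v x) : ℂ) * w x *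
        iteratedDerivWithin (k + 1) g (Ici 0) s)
      (ρ.prod (volume.restrict (Ioc 0 L))) := by
  have hgint := intervalIntegrable_mul_iteratedDerivWithin hg hL
    (f := fun _ => 1) continuousOn_const (k + 1)
  simp only [one_mul] at hgint
  rw [intervalIntegrable_iff_integrableOn_Ioc_of_le hL] at hgint
  have hmeas : Measurable fun p : X × ℝ => (truncPow k p.2 (v p.1) : ℂ) := by
    unfold truncPow; fun_prop
  simp only [Function.uncurry_def, mul_assoc]
  refine (hw.mul_prod hgint).bdd_mul (c := L ^ k / (Nat.factorial k : ℝ))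
    hmeas.aestronglyMeasurable ?_
  filter_upwards [Measure.quasiMeasurePreserving_snd.ae (ae_restrict_mem measurableSet_Ioc)]
    with p hp
  exact norm_truncPow_le (hv₀ p.1) (Ioc_subset_Icc_self hp)

theorem integral_integral_truncPow [SFinite ρ] (hg : ContDiffOn ℝ ∞ g (Ici 0)) (hL : 0 ≤ L)
    (hv : Measurable v) (hv₀ : ∀ x, 0 ≤ v x) (hw : Integrable w ρ) (k : ℕ) :
    ∫ s in (0 : ℝ)..L, (∫ x, (truncPow k s (v x) : ℂ) * w x ∂ρ) *
        iteratedDerivWithin (k + 1) g (Ici 0) s =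
      ∫ x, (∫ s in (0 : ℝ)..L, (truncPow k s (v x) : ℂ) *
        iteratedDerivWithin (k + 1) g (Ici 0) s) * w x ∂ρ := by
  simp only [intervalIntegral.integral_of_le hL, ← integral_mul_const]
  rw [← integral_integral_swap (integrable_truncPow_mul_prod hg hL hv hv₀ hw k)]
  simp only [mul_right_comm _ (w _)]

theorem integral_comp_mul_eq_sum_add_integral [SFinite ρ] (hg : ContDiffOn ℝ ∞ g (Ici 0))
    (hk : k ≠ 0) (hL : 0 ≤ L) (hv : Measurable v) (hv₀ : ∀ x, 0 ≤ v x) (hvL : ∀ᵐ x ∂ρ, v x < L)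
    (hw : Integrable w ρ) :
    ∫ x, g (v x) * w x ∂ρ =
      ∑ j ∈ Finset.range (k + 1), (-1) ^ j *
        (∫ x, (((L - v x) ^ j / (Nat.factorial j : ℝ) : ℝ) : ℂ) * w x ∂ρ) *
          iteratedDerivWithin j g (Ici 0) L
      + (-1) ^ (k + 1) * ∫ s in (0 : ℝ)..L, (∫ x, (truncPow k s (v x) : ℂ) * w x ∂ρ) *
          iteratedDerivWithin (k + 1) g (Ici 0) s := by
  have hpoly (j : ℕ) :
      Integrable (fun x => (((L - v x) ^ j / (Nat.factorial j : ℝ) : ℝ) : ℂ) * w x) ρ := by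
    refine hw.bdd_mul (c := L ^ j / (Nat.factorial j : ℝ))
      (Measurable.aestronglyMeasurable (by fun_prop)) ?_
    filter_upwards [hvL] with x hx
    rw [← truncPow_of_le hx.le]
    exact norm_truncPow_le (hv₀ x) ⟨hL, le_rfl⟩
  have hrem := (integrable_truncPow_mul_prod hg hL hv hv₀ hw k).integral_prod_left
  have hrem' : Integrable (fun x => (∫ s in (0 : ℝ)..L, (truncPow k s (v x) : ℂ) *
      iteratedDerivWithin (k + 1) g (Ici 0) s) * w x) ρ := by
    refine hrem.congr (.of_forall fun x => ?_)
    simp only [Function.uncurry, intervalIntegral.integral_of_le hL, ← integral_mul_const]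
    exact integral_congr_ae (.of_forall fun s => by ring)
  rw [integral_integral_truncPow hg hL hv hv₀ hw]
  simp only [← integral_const_mul, ← integral_mul_const]
  rw [← integral_finsetSum _ fun j _ => ((hpoly j).const_mul _).mul_const _, ← integral_add
    (integrable_finsetSum _ fun j _ => ((hpoly j).const_mul _).mul_const _) (hrem'.const_mul _)]
  refine integral_congr_ae ?_
  filter_upwards [hvL] with x hx
  rw [integral_truncPow_mul hg hk (hv₀ x) hx.le, taylor_Ici hg k (hv₀ x) hx, add_mul,
    Finset.sum_mul]
  congr 1
  · exact Finset.sum_congr rfl fun j _ => by ring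
  · ring

end Taylor

section RieszMean

variable {d : ℕ} {g : ℝ → ℂ} {k : ℕ} {L : ℝ}

theorem setIntegral_comp_norm_sq_mul_e (hg : ContDiffOn ℝ ∞ g (Ici 0)) (hk : k ≠ 0) (hL : 0 ≤ L)
    (x : E d) :
    ∫ ξ in {ξ : E d | ‖ξ‖ ^ 2 < L}, g (‖ξ‖ ^ 2) * e ξ x =
      ∑ j ∈ Finset.range (k + 1), (-1) ^ j * Dint j L x * iteratedDerivWithin j g (Ici 0) L
      + (-1) ^ (k + 1) * ∫ s in (0 : ℝ)..L, Dint k s x *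
          iteratedDerivWithin (k + 1) g (Ici 0) s := by
  have htaylor := integral_comp_mul_eq_sum_add_integral
    (ρ := volume.restrict {ξ : E d | ‖ξ‖ ^ 2 < L}) hg hk hL (by fun_prop)
    (fun ξ => sq_nonneg ‖ξ‖) (ae_restrict_mem (measurableSet_norm_sq_lt L))
    (integrableOn_norm_sq_lt L (continuous_e_left x))
  simp only [← Dint_natCast] at htaylor
  rw [htaylor]
  congr 2
  refine intervalIntegral.integral_congr fun s hs => ?_
  rw [uIcc_of_le hL] at hs
  simp only [Dint_eq_setIntegral_truncPow hk hs.2]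

theorem sum_comp_norm_sq_mul_e (hg : ContDiffOn ℝ ∞ g (Ici 0)) (hk : k ≠ 0) (hL : 0 ≤ L)
    (x : E d) :
    ∑ m ∈ (finite_norm_sq_lt d L).toFinset, g (‖latt m‖ ^ 2) * e (latt m) x =
      ∑ j ∈ Finset.range (k + 1), (-1) ^ j * Dsum j L x * iteratedDerivWithin j g (Ici 0) L
      + (-1) ^ (k + 1) * ∫ s in (0 : ℝ)..L, Dsum k s x *
          iteratedDerivWithin (k + 1) g (Ici 0) s := by
  have hlt (m : (finite_norm_sq_lt d L).toFinset) : ‖latt m.1‖ ^ 2 < L :=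
    (finite_norm_sq_lt d L).mem_toFinset.mp m.2
  have hDsum : ∫ s in (0 : ℝ)..L, Dsum k s x * iteratedDerivWithin (k + 1) g (Ici 0) s =
      ∫ s in (0 : ℝ)..L, (∑ m ∈ (finite_norm_sq_lt d L).toFinset,
        (truncPow k s (‖latt m‖ ^ 2) : ℂ) * e (latt m) x) *
          iteratedDerivWithin (k + 1) g (Ici 0) s := by
    refine intervalIntegral.integral_congr fun s hs => ?_
    rw [uIcc_of_le hL] at hs
    simp only [Dsum_eq_sum_truncPow hk hs.2]
  have htaylor := integral_comp_mul_eq_sum_add_integral (ρ := .count) hg hk hL .of_discrete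
    (fun _ => sq_nonneg _) (.of_forall hlt) (w := fun m => e (latt m.1) x) .of_finite
  simp only [integral_count] at htaylor
  rw [hDsum]
  simpa only [Dsum_natCast, ← Finset.sum_coe_sort (finite_norm_sq_lt d L).toFinset]

end RieszMean

section LatticeExpansion

variable {d : ℕ} [NeZero d] {k : ℕ} {L : ℝ}

theorem hasSum_integral_Dint_mul (hk : d ≤ 2 * k) (hL : 0 ≤ L) {h : ℝ → ℂ}
    (hh : IntervalIntegrable h volume 0 L) (x : E d) :
    HasSum (fun m : {m : Fin d → ℤ // m ≠ 0} =>
        ∫ s in (0 : ℝ)..L, Dint k s (x - latt m.1) * h s)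
      (∫ s in (0 : ℝ)..L, Delta k s x * h s) := by
  obtain ⟨b, hb, hDint⟩ := exists_summable_norm_Dint_le hk L x
  have hsub : uIoc 0 L ⊆ Icc 0 L := by rw [uIoc_of_le hL]; exact Ioc_subset_Icc_self
  have hb' := hb.subtype {m : Fin d → ℤ | m ≠ 0}
  refine intervalIntegral.hasSum_integral_of_dominated_convergence (fun m s => b m.1 * ‖h s‖)
    (fun m => ?_) (fun m => .of_forall fun s hs => ?_) (.of_forall fun s _ => hb'.mul_right _) ?_
    (.of_forall fun s hs => (hasSum_Dint_ne_zero hk (hsub hs).1 x).mul_right _)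
  · exact (((continuousOn_Dint k _).mono (hsub.trans Icc_subset_Ici_self)).aestronglyMeasurable
      measurableSet_uIoc).mul hh.def'.aestronglyMeasurable
  · rw [norm_mul]
    gcongr
    exact hDint m.1 s (hsub hs)
  · simpa only [tsum_mul_right] using hh.norm.const_mul _

theorem sum_eq_setIntegral_add_sum_Delta {g : ℝ → ℂ} (hg : ContDiffOn ℝ ∞ g (Ici 0))
    (hk : d ≤ 2 * k) (hL : 0 ≤ L) (x : E d) :
    ∑ m ∈ (finite_norm_sq_lt d L).toFinset, g (‖latt m‖ ^ 2) * e (latt m) x =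
      (∫ ξ in {ξ : E d | ‖ξ‖ ^ 2 < L}, g (‖ξ‖ ^ 2) * e ξ x)
      + ∑ j ∈ Finset.range (k + 1), (-1) ^ j * Delta j L x * iteratedDerivWithin j g (Ici 0) L
      + (-1) ^ (k + 1) * ∫ s in (0 : ℝ)..L, Delta k s x *
          iteratedDerivWithin (k + 1) g (Ici 0) s := by
  have hk₀ : k ≠ 0 := by have := NeZero.ne d; omega
  have hDelta : ∫ s in (0 : ℝ)..L, Delta k s x * iteratedDerivWithin (k + 1) g (Ici 0) s =
      (∫ s in (0 : ℝ)..L, Dsum k s x * iteratedDerivWithin (k + 1) g (Ici 0) s)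
      - ∫ s in (0 : ℝ)..L, Dint k s x * iteratedDerivWithin (k + 1) g (Ici 0) s := by
    rw [← intervalIntegral.integral_sub
      (intervalIntegrable_mul_iteratedDerivWithin hg hL
        ((continuousOn_Dsum hk₀ x L).mono Icc_subset_Iic_self) _)
      (intervalIntegrable_mul_iteratedDerivWithin hg hL
        ((continuousOn_Dint k x).mono Icc_subset_Ici_self) _)]
    simp only [Delta, sub_mul]
  rw [sum_comp_norm_sq_mul_e hg hk₀ hL, setIntegral_comp_norm_sq_mul_e hg hk₀ hL, hDelta]
  simp only [Delta, mul_sub, sub_mul, Finset.sum_sub_distrib]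
  ring

end LatticeExpansion

section RadialTransform

theorem hasDerivAt_integral_mul_besselClifford {a b : ℝ} {w : ℝ → ℂ} {c : ℝ → ℝ}
    (hw : IntervalIntegrable w volume a b) (hc : Continuous c) (ν s : ℝ) :
    HasDerivAt (fun s => ∫ t in a..b, w t * besselClifford ν (c t * s))
      (∫ t in a..b, -c t * w t * besselClifford (ν + 1) (c t * s)) s := by
  have hw' : IntervalIntegrable (fun t => -c t * w t) volume a b :=
    hw.continuousOn_mul (by fun_prop)
  obtain ⟨C, hC⟩ := ((isCompact_Icc (a := s - 1) (b := s + 1)).prod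
    (isCompact_uIcc (a := a) (b := b))).exists_bound_of_continuousOn
    (f := fun p : ℝ × ℝ => besselClifford (ν + 1) (c p.2 * p.1)) (by fun_prop)
  refine (intervalIntegral.hasDerivAt_integral_of_dominated_loc_of_deriv_le
    (bound := fun t => ‖-c t * w t‖ * C)
    (F := fun s t => w t * besselClifford ν (c t * s))
    (F' := fun s t => -c t * w t * besselClifford (ν + 1) (c t * s))
    (Icc_mem_nhds (sub_one_lt s) (lt_add_one s)) (.of_forall fun y => ?_) ?_ ?_
    (.of_forall fun t ht y hy => ?_) (hw'.norm.mul_const C) (.of_forall fun t _ y _ => ?_)).2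
  · exact (hw.mul_continuousOn (by fun_prop)).def'.aestronglyMeasurable
  · exact hw.mul_continuousOn (by fun_prop)
  · exact (hw'.mul_continuousOn (by fun_prop)).def'.aestronglyMeasurable
  · rw [norm_mul, Complex.norm_real]
    gcongr
    exact hC (y, t) ⟨hy, uIoc_subset_uIcc ht⟩
  · have hinner : HasDerivAt (fun y => c t * y) (c t) y := by
      simpa using (hasDerivAt_id y).const_mul (c t)
    refine ((((hasDerivAt_besselClifford ν _).comp y hinner).ofReal_comp).const_mul
      (w t)).congr_deriv ?_
    push_cast
    ring

theorem contDiff_integral_mul_besselClifford {a b : ℝ} {w : ℝ → ℂ} {c : ℝ → ℝ}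
    (hw : IntervalIntegrable w volume a b) (hc : Continuous c) (ν : ℝ) :
    ContDiff ℝ ∞ fun s => ∫ t in a..b, w t * besselClifford ν (c t * s) := by
  rw [contDiff_infty]
  intro n
  induction n generalizing w ν with
  | zero =>
    exact contDiff_zero.mpr <| continuous_iff_continuousAt.mpr fun s =>
      (hasDerivAt_integral_mul_besselClifford hw hc ν s).continuousAt
  | succ n ih =>
    have hderiv := hasDerivAt_integral_mul_besselClifford hw hc ν
    rw [Nat.cast_add_one, contDiff_succ_iff_deriv, funext fun s => (hderiv s).deriv]
    exact ⟨fun s => (hderiv s).differentiableAt, by simp,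
      ih (hw.continuousOn_mul (by fun_prop)) (ν + 1)⟩

theorem exists_forall_gt_eq_zero {φ : ℝ≥0 → ℂ} (hφ : HasCompactSupport φ) :
    ∃ R : ℝ≥0, ∀ t, R < t → φ t = 0 := by
  obtain ⟨R, hR⟩ := hφ.isCompact.bddAbove
  exact ⟨R, fun t ht => by_contra fun h => ht.not_ge (hR (subset_tsupport _ h))⟩

variable {d : ℕ} {φ : ℝ≥0 → ℂ}

theorem radial_eq_comp_toNNReal_norm (φ : ℝ≥0 → ℂ) (x : E d) :
    radial d φ x = φ (‖x‖ : ℝ).toNNReal := by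
  rw [radial, norm_toNNReal]

variable [NeZero d]

theorem integrableOn_pow_mul_of_integrable_radial (hφ : Integrable (radial d φ)) :
    IntegrableOn (fun t : ℝ => (t : ℂ) ^ (d - 1) * φ t.toNNReal) (Ioi 0) := by
  have hpolar := (integrable_fun_norm_addHaar (volume : Measure (E d))
    (f := fun t : ℝ => φ t.toNNReal)).mp (hφ.congr (.of_forall (radial_eq_comp_toNNReal_norm φ)))
  simpa using hpolar

theorem A_eq_integral_besselClifford (φ : ℝ≥0 → ℂ) {s : ℝ} (hs : 0 ≤ s) :
    A d φ s = ∫ t in Ioi (0 : ℝ), 2 * ((Real.pi ^ (d / 2 : ℝ) : ℝ) : ℂ) *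
      ((t : ℂ) ^ (d - 1) * φ t.toNNReal) *
        besselClifford (d / 2 - 1) (Real.pi ^ 2 * t ^ 2 * s) := by
  rw [A, ← integral_const_mul]
  refine setIntegral_congr_fun measurableSet_Ioi fun t (ht : 0 < t) => ?_
  have hpow : t ^ (d / 2 - 1 : ℝ) * t ^ (d / 2 : ℝ) = t ^ (d - 1) := by
    rw [← Real.rpow_add ht, ← Real.rpow_natCast, Nat.cast_pred (NeZero.pos d)]
    congr 1
    ring
  have hLam : Real.pi * (Lam (d / 2 - 1) t s * t ^ (d / 2 : ℝ)) =
      Real.pi ^ (d / 2 : ℝ) * t ^ (d - 1) *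
        besselClifford (d / 2 - 1) (Real.pi ^ 2 * t ^ 2 * s) := by
    rw [Lam_eq_besselClifford _ ht hs, Real.mul_rpow Real.pi_pos.le ht.le,
      Real.rpow_sub_one Real.pi_ne_zero, ← hpow]
    field_simp
  replace hLam := congrArg (fun y : ℝ => (y : ℂ)) hLam
  push_cast at hLam ⊢
  linear_combination 2 * φ t.toNNReal * hLam

theorem fourier_radial (hφ : Integrable (radial d φ)) (ξ : E d) :
    𝓕 (radial d φ) ξ = A d φ (‖ξ‖ ^ 2) := by
  have hexp := integral_radial_mul_exp (ψ := fun t : ℝ => φ t.toNNReal)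
    (hφ.congr (.of_forall (radial_eq_comp_toNNReal_norm φ))) (-ξ)
  simp only [finrank_euclideanSpace_fin, norm_neg] at hexp
  rw [A_eq_integral_besselClifford φ (sq_nonneg _), fourier_eq_integral_mul_e]
  refine .trans (integral_congr_ae (.of_forall fun x => ?_)) (hexp.trans ?_)
  · simp only [radial_eq_comp_toNNReal_norm, e, real_inner_comm]
  · refine integral_congr_ae (.of_forall fun t => ?_)
    simp only [mul_right_comm _ (‖ξ‖ ^ 2)]
    push_cast
    ring

theorem contDiffOn_A (hφ : HasCompactSupport φ) (hφ' : Integrable (radial d φ)) :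
    ContDiffOn ℝ ∞ (A d φ) (Ici 0) := by
  obtain ⟨R, hR⟩ := exists_forall_gt_eq_zero hφ
  have hw : IntervalIntegrable (fun t : ℝ => 2 * ((Real.pi ^ (d / 2 : ℝ) : ℝ) : ℂ) *
      ((t : ℂ) ^ (d - 1) * φ t.toNNReal)) volume 0 R := by
    rw [intervalIntegrable_iff_integrableOn_Ioc_of_le R.coe_nonneg]
    exact ((integrableOn_pow_mul_of_integrable_radial hφ').mono_set Ioc_subset_Ioi_self).const_mul _
  refine (contDiff_integral_mul_besselClifford hw (c := fun t => Real.pi ^ 2 * t ^ 2)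
    (by fun_prop) (d / 2 - 1)).contDiffOn.congr fun s hs => ?_
  rw [A_eq_integral_besselClifford φ hs, intervalIntegral.integral_of_le R.coe_nonneg]
  refine setIntegral_eq_of_subset_of_forall_sdiff_eq_zero measurableSet_Ioi
    (Ioc_subset_Ioi_self (a := (R : ℝ))) fun t ht => ?_
  have hRt : R < t.toNNReal :=
    Real.lt_toNNReal_iff_coe_lt.mpr (not_le.mp fun h => ht.2 ⟨ht.1, h⟩)
  rw [hR _ hRt, mul_zero, mul_zero, zero_mul]

theorem sphericalSum_periodization_radial (hφ : Integrable (radial d φ)) {r : ℝ} (hr : 0 ≤ r)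
    (x : E d) :
    sphericalSum r (periodization (radial d φ)) x =
      ∑ m ∈ (finite_norm_sq_lt d (r ^ 2)).toFinset, A d φ (‖latt m‖ ^ 2) * e (latt m) x := by
  have hball : (finite_norm_lt d r).toFinset = (finite_norm_sq_lt d (r ^ 2)).toFinset := by
    ext m
    simp only [Finite.mem_toFinset, mem_ofPred_eq, sq_lt_sq₀ (norm_nonneg _) hr]
  simp only [sphericalSum, hball, fourierCoefficient_periodization hφ, fourier_radial hφ]

theorem sphericalIntegral_radial (hφ : Integrable (radial d φ)) {r : ℝ} (hr : 0 ≤ r) (x : E d) :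
    sphericalIntegral r (radial d φ) x =
      ∫ ξ in {ξ : E d | ‖ξ‖ ^ 2 < r ^ 2}, A d φ (‖ξ‖ ^ 2) * e ξ x := by
  simp only [sphericalIntegral, sq_lt_sq₀ (norm_nonneg _) hr, fourier_radial hφ]

end RadialTransform

section PowerFamily

theorem hasCompactSupport_phiBeta (β a : ℝ) : HasCompactSupport (phiBeta β a) := by
  refine .of_support_subset_isCompact (isCompact_Icc (a := 0) (b := a.toNNReal)) fun t ht => ?_
  refine ⟨zero_le, NNReal.le_toNNReal_of_coe_le (le_of_lt ?_)⟩
  by_contra h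
  exact ht (if_neg h)

theorem integrableOn_pow_mul_sq_sub_sq_rpow (n : ℕ) {β a : ℝ} (hβ : -1 < β) (ha : 0 < a) :
    IntegrableOn (fun t : ℝ => t ^ n * (a ^ 2 - t ^ 2) ^ β) (Ioo 0 a) := by
  have hsub : IntegrableOn (fun t : ℝ => (a - t) ^ β) (Icc 0 a) := by
    have := ((intervalIntegral.intervalIntegrable_rpow' hβ).comp_sub_left a
      (a := 0) (b := a)).symm.1
    rwa [sub_self, sub_zero, ← integrableOn_Icc_iff_integrableOn_Ioc] at this
  have hadd : ContinuousOn (fun t : ℝ => t ^ n * (a + t) ^ β) (Icc 0 a) :=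
    (continuousOn_pow n).mul ((continuousOn_const.add continuousOn_id).rpow_const
      fun t ht => .inl (add_pos_of_pos_of_nonneg ha ht.1).ne')
  refine ((hsub.continuousOn_mul hadd isCompact_Icc).mono_set Ioo_subset_Icc_self).congr_fun
    (fun t ht => ?_) measurableSet_Ioo
  rw [sq_sub_sq, Real.mul_rpow (by linarith [ht.1]) (by linarith [ht.2]), ← mul_assoc]

theorem integrable_U {d : ℕ} [NeZero d] {β a : ℝ} (hβ : -1 < β) (ha : 0 < a) :
    Integrable (U d β a) := by
  have hball := (integrableOn_fun_norm_addHaar (volume : Measure (E d)) (r := a)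
    (f := fun t : ℝ => (((a ^ 2 - t ^ 2) ^ β : ℝ) : ℂ))).mpr <| by
      simpa [IntegrableOn] using (integrableOn_pow_mul_sq_sub_sq_rpow (d - 1) hβ ha).ofReal (𝕜 := ℂ)
  rw [← integrable_indicator_iff measurableSet_ball] at hball
  exact hball.congr (.of_forall fun x => by simp [indicator, U])

end PowerFamily

end LatticeFourier

end

theorem theorem2p1_general {d k : ℕ} [NeZero d] (hk : d ≤ 2 * k) {φ : ℝ≥0 → ℂ}
    (hφ : HasCompactSupport φ) (hφ' : Integrable (radial d φ)) :
    IntegrableOn (periodization (radial d φ)) (torus d) ∧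
    ContDiffOn ℝ ∞ (A d φ) (Ici 0) ∧
    ∀ r : ℝ, 0 ≤ r → ∀ x : E d,
      (∀ m : Fin d → ℤ, IntervalIntegrable
        (fun s => Dint k s (x - latt m) * Aderiv d φ (k + 1) s) volume 0 (r ^ 2)) ∧
      Summable (fun m : {m : Fin d → ℤ // m ≠ 0} =>
        ∫ s in (0 : ℝ)..r ^ 2, Dint k s (x - latt m.1) * Aderiv d φ (k + 1) s) ∧
      sphericalSum r (periodization (radial d φ)) x =
        sphericalIntegral r (radial d φ) x
        + ∑ j ∈ Finset.range (k + 1), (-1) ^ j * Delta j (r ^ 2) x * Aderiv d φ j (r ^ 2)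
        + (-1) ^ (k + 1) * ∑' m : {m : Fin d → ℤ // m ≠ 0},
            ∫ s in (0 : ℝ)..r ^ 2, Dint k s (x - latt m.1) * Aderiv d φ (k + 1) s := by
  have hA := contDiffOn_A hφ hφ'
  refine ⟨integrableOn_periodization hφ', hA, fun r hr x => ?_⟩
  have hL := sq_nonneg r
  have hint {f : ℝ → ℂ} (hf : ContinuousOn f (Icc 0 (r ^ 2))) :=
    intervalIntegrable_mul_iteratedDerivWithin hA hL hf (k + 1)
  have hsum := hasSum_integral_Dint_mul hk hL
    (by simpa only [one_mul] using hint (f := fun _ => 1) continuousOn_const) x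
  refine ⟨fun m => hint ((continuousOn_Dint k _).mono Icc_subset_Ici_self), hsum.summable, ?_⟩
  rw [sphericalSum_periodization_radial hφ' hr, sphericalIntegral_radial hφ' hr,
    sum_eq_setIntegral_add_sum_Delta hA hk hL, ← hsum.tsum_eq]
  rfl

theorem theorem2p1 (d : ℕ) (hd : 1 ≤ d) :
    (∀ φ : ℝ≥0 → ℂ, HasCompactSupport φ → Integrable (radial d φ) →
      IntegrableOn (periodization (radial d φ)) (torus d) ∧
      ContDiffOn ℝ ∞ (A d φ) (Ici 0) ∧
      ∀ r : ℝ, 0 ≤ r → ∀ x ∈ torus d,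
        (∀ m : Fin d → ℤ, IntervalIntegrable
          (fun s => Dint (dSharp d) s (x - latt m) * Aderiv d φ (dSharp d + 1) s)
          volume 0 (r ^ 2)) ∧
        Summable (fun m : {m : Fin d → ℤ // m ≠ 0} =>
          ∫ s in (0 : ℝ)..r ^ 2,
            Dint (dSharp d) s (x - latt m.1) * Aderiv d φ (dSharp d + 1) s) ∧
        sphericalSum r (periodization (radial d φ)) x =
          sphericalIntegral r (radial d φ) x
          + ∑ j ∈ Finset.range (dSharp d + 1),
              (-1) ^ j * Delta j (r ^ 2) x * Aderiv d φ j (r ^ 2)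
          + (-1) ^ (dSharp d + 1) * ∑' m : {m : Fin d → ℤ // m ≠ 0},
              ∫ s in (0 : ℝ)..r ^ 2,
                Dint (dSharp d) s (x - latt m.1) * Aderiv d φ (dSharp d + 1) s) ∧
    (∀ β a : ℝ, -1 < β → 0 < a →
      Integrable (U d β a) ∧
      IntegrableOn (u d β a) (torus d) ∧
      ContDiffOn ℝ ∞ (A d (phiBeta β a)) (Ici 0) ∧
      ∀ r : ℝ, 0 ≤ r → ∀ x ∈ torus d,
        (∀ m : Fin d → ℤ, IntervalIntegrable
          (fun s => Dint (dSharp d) s (x - latt m) * Aderiv d (phiBeta β a) (dSharp d + 1) s)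
          volume 0 (r ^ 2)) ∧
        Summable (fun m : {m : Fin d → ℤ // m ≠ 0} =>
          ∫ s in (0 : ℝ)..r ^ 2,
            Dint (dSharp d) s (x - latt m.1) * Aderiv d (phiBeta β a) (dSharp d + 1) s) ∧
        sphericalSum r (u d β a) x =
          sphericalIntegral r (U d β a) x
          + ∑ j ∈ Finset.range (dSharp d + 1),
              (-1) ^ j * Delta j (r ^ 2) x * Aderiv d (phiBeta β a) j (r ^ 2)
          + (-1) ^ (dSharp d + 1) * ∑' m : {m : Fin d → ℤ // m ≠ 0},
              ∫ s in (0 : ℝ)..r ^ 2,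
                Dint (dSharp d) s (x - latt m.1) *
                  Aderiv d (phiBeta β a) (dSharp d + 1) s) := by
  have : NeZero d := ⟨by omega⟩
  have hk : d ≤ 2 * dSharp d := by unfold dSharp; omega
  have expansion (φ : ℝ≥0 → ℂ) (hφ : HasCompactSupport φ) (hφ' : Integrable (radial d φ)) :=
    And.imp_right (And.imp_right fun h r hr x (_ : x ∈ torus d) => h r hr x)
      (theorem2p1_general hk hφ hφ')
  exact ⟨expansion, fun β a hβ ha => have hU := integrable_U hβ ha
    ⟨hU, expansion _ (hasCompactSupport_phiBeta β a) hU⟩⟩
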